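/- Let $d\ge 1$, $R>0$ and $0<\lambda_{\min}<\lambda_{\max}$. Let $\mathbb S_d^+(\lambda_{\min},\lambda_{\max})$ be the set of symmetric positive definite $d\times d$ matrices with all eigenvalues in $[\lambda_{\min},\lambda_{\max}]$, let $\|S\|_{\mathrm{op}}=\max_{\|v\|\le1}|v^\top Sv|$ for symmetric $S$, and let $$f(x\mid\theta,\Sigma)=\frac{\Gamma\left(\frac{1+d}{2}\right)}{\pi^{\frac{d+1}{2}}|\Sigma|^{\frac12}\left[1+(x-\theta)^\top\Sigma^{-1}(x-\theta)\right]^{\frac{d+1}{2}}}$$ be the multivariate Cauchy kernel on $\mathbb R^d$, where $|\Sigma|$ is the determinant, with characteristic function $\Phi_\Sigma(\xi)=\int_{\mathbb R^d}e^{i\xi^\top x}f(x\mid0,\Sigma)\,dx$. For a measurable set $\mathcal X\subseteq\bar B(0,R)\subseteq\mathbb R^d$ let $\mathscr G$ be the set of all $G=P\times\delta_\Sigma$, where $P$ is a Borel probability measure on $\mathbb R^d$ with $\mathrm{supp}(P)\subseteq\mathcal X$ and $\Sigma\in\mathbb S_d^+(\lambda_{\min},\lambda_{\max})$, and put $p_G(x)=\int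 f(x\mid\theta,\Sigma)\,P(d\theta)$. Let $\|\cdot\|_1$ be the norm of $L^1(\mathbb R^d)$, let $W_1$ be the $1$-Wasserstein distance for the Euclidean metric, and read $\exp(-C/0)$ as $0$. 1. (Super-smoothness of order $1$.) There are $c_1,c_2>0$, depending only on $\lambda_{\min},\lambda_{\max},d$, such that for all $\xi\in\mathbb R^d$ and $\Sigma\in\mathbb S_d^+(\lambda_{\min},\lambda_{\max})$, $$\exp(-c_1\|\xi\|)\le|\Phi_\Sigma(\xi)|\le\exp(-c_2\|\xi\|).$$ 2. (Identifiability of the scale in $L^1$, with $\Psi(t)=t^2$.) There is $C_0>0$, depending only on $R,\lambda_{\min},\lambda_{\max},d$, such that for all $G=P\times\delta_\Sigma$ and $G'=P'\times\delta_{\Sigma'}$ in $\mathscr G$, $$\|p_G-p_{G'}\|_1\ge C_0\|\Sigma-\Sigma'\|_{\mathrm{op}}^2.$$ 3. (Modulus of the characteristic function, with $\Xi(t)=\sqrt t$ and $p=1$.) There is $C_1>0$, depending only on $\lambda_{\min},\lambda_{\max},d$, such that for all $\xi\in\mathbb R^d$ and $\Sigma,\Sigma'\in\mathbb S_d^+(\lambda_{\min},\lambda_{\max})$,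 $$|\Phi_{\Sigma'}(\xi)-\Phi_\Sigma(\xi)|\le C_1\sqrt{\|\Sigma-\Sigma'\|_{\mathrm{op}}}\,\|\xi\|\max\{|\Phi_{\Sigma'}(\xi)|,|\Phi_\Sigma(\xi)|\}.$$ 4. There are $C,C'>0$, depending only on $R,\lambda_{\min},\lambda_{\max},d$, such that for all $G=P\times\delta_\Sigma$ and $G'=P'\times\delta_{\Sigma'}$ in $\mathscr G$, $$\|p_G-p_{G'}\|_1\ge C'\left[\exp\left(-\frac{C}{W_1(P,P')}\right)+\|\Sigma-\Sigma'\|_{\mathrm{op}}^2\right].$$ -/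

import Mathlib

open MeasureTheory

noncomputable section

/-- Euclidean space `ℝ^d`. -/
abbrev Euc (d : ℕ) : Type := EuclideanSpace ℝ (Fin d)

/-- The quadratic form `v ↦ vᵀ A v` of a real square matrix. -/
def quadForm {d : ℕ} (A : Matrix (Fin d) (Fin d) ℝ) (v : Euc d) : ℝ :=
  v.ofLp ⬝ᵥ A.mulVec v.ofLp

/-- `max_{‖v‖ ≤ 1} |vᵀ S v|`, which is the operator norm of a symmetric matrix `S`. -/
def symOpNorm {d : ℕ} (S : Matrix (Fin d) (Fin d) ℝ) : ℝ :=
  ⨆ v : Metric.closedBall (0 : Euc d) 1, |quadForm S v|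

/-- The symmetric positive definite `d × d` matrices all of whose eigenvalues lie in
`[lmin, lmax]`. -/
def boundedPosDef (d : ℕ) (lmin lmax : ℝ) : Set (Matrix (Fin d) (Fin d) ℝ) :=
  {S | ∃ hS : S.PosDef, ∀ i, lmin ≤ hS.isHermitian.eigenvalues i ∧
    hS.isHermitian.eigenvalues i ≤ lmax}

/-- The type of location-scale kernels `f x θ S`, standing for `f(x ∣ θ, S)`. -/
abbrev LocScaleKernel (d : ℕ) : Type :=
  Euc d → Euc d → Matrix (Fin d) (Fin d) ℝ → ℝ

/-- The multivariate Cauchy kernel. -/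
def cauchyKernel (d : ℕ) : LocScaleKernel d := fun x θ S =>
  Real.Gamma ((1 + (d : ℝ)) / 2) /
    (Real.pi ^ (((d : ℝ) + 1) / 2) * S.det ^ (1 / 2 : ℝ) *
      (1 + quadForm S⁻¹ (x - θ)) ^ (((d : ℝ) + 1) / 2))

/-- The characteristic function `Φ_S(ξ) = ∫ e^{i ξᵀx} f(x ∣ 0, S) dx` of a kernel. -/
def kernelCharFun {d : ℕ} (f : LocScaleKernel d) (S : Matrix (Fin d) (Fin d) ℝ)
    (ξ : Euc d) : ℂ :=
  ∫ x : Euc d, Complex.exp (Complex.I * (inner ℝ ξ x : ℝ)) * (f x 0 S : ℂ)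

/-- The parameter space: a pair `G = (P, S)` stands for the mixing measure `P × δ_S`, where the
support of the probability measure `P` lies in `X` and `S` has eigenvalues in `[lmin, lmax]`. -/
def mixingSpace {d : ℕ} (X : Set (Euc d)) (lmin lmax : ℝ) :
    Set (ProbabilityMeasure (Euc d) × Matrix (Fin d) (Fin d) ℝ) :=
  {G | (G.1 : Measure (Euc d)).support ⊆ X ∧ G.2 ∈ boundedPosDef d lmin lmax}

/-- The mixture density `p_G(x) = ∫ f(x ∣ θ, S) P(dθ)` for `G = (P, S)`. -/
def mixtureDensity {d : ℕ} (f : LocScaleKernel d)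
    (G : ProbabilityMeasure (Euc d) × Matrix (Fin d) (Fin d) ℝ) (x : Euc d) : ℝ :=
  ∫ θ, f x θ G.2 ∂(G.1 : Measure (Euc d))

/-- The `L¹` distance with respect to Lebesgue measure. -/
def l1Dist {d : ℕ} (p q : Euc d → ℝ) : ℝ := ∫ x, |p x - q x|

/-- The `1`-Wasserstein distance for the Euclidean ground metric: the infimum of
`∫ ‖x - y‖ γ(dx, dy)` over all couplings `γ`. It is finite for measures of bounded support. -/
def wasserstein1 {d : ℕ} (P Q : ProbabilityMeasure (Euc d)) : ℝ :=
  (⨅ γ ∈ {γ : Measure (Euc d × Euc d) |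
      γ.map Prod.fst = (P : Measure (Euc d)) ∧ γ.map Prod.snd = (Q : Measure (Euc d))},
    ∫⁻ z, edist z.1 z.2 ∂γ).toReal

/-- `exp (-C / w)` for `w ≥ 0`, with its limiting value `0` at `w = 0`. -/
def expNegDiv (C w : ℝ) : ℝ := if w = 0 then 0 else Real.exp (-(C / w))

/-- The kernel `f` is super-smooth of order `α`; the constants depend on `f` (hence on `d`),
`lmin`, `lmax` and `α` only. -/
def IsSuperSmooth {d : ℕ} (f : LocScaleKernel d) (lmin lmax α : ℝ) : Prop :=
  0 < α ∧ ∃ c₁ > 0, ∃ c₂ > 0, ∀ ξ : Euc d, ∀ S ∈ boundedPosDef d lmin lmax,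
    Real.exp (-c₁ * ‖ξ‖ ^ α) ≤ ‖kernelCharFun f S ξ‖ ∧
      ‖kernelCharFun f S ξ‖ ≤ Real.exp (-c₂ * ‖ξ‖ ^ α)

/-- `Ψ` restricts to a strictly increasing function `[0, ∞) → [0, ∞)`. -/
def IsGauge (Ψ : ℝ → ℝ) : Prop :=
  Set.MapsTo Ψ (Set.Ici 0) (Set.Ici 0) ∧ StrictMonoOn Ψ (Set.Ici 0)

/-- The `L¹` distance between mixtures is bounded below, up to a constant, by `Ψ` of the
distance between the scale matrices. The constant is uniform over all location sets contained in
the ball of radius `R`. -/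
def ScaleLowerBound {d : ℕ} (f : LocScaleKernel d) (R lmin lmax : ℝ) (Ψ : ℝ → ℝ) : Prop :=
  IsGauge Ψ ∧ ∃ C > 0, ∀ X : Set (Euc d), MeasurableSet X → X ⊆ Metric.closedBall 0 R →
    ∀ G ∈ mixingSpace X lmin lmax, ∀ G' ∈ mixingSpace X lmin lmax,
      C * Ψ (symOpNorm (G.2 - G'.2)) ≤ l1Dist (mixtureDensity f G) (mixtureDensity f G')

/-- The characteristic function of the kernel varies with the scale matrix in a way controlled
by `Ξ` and a polynomial of degree `p` in `‖ξ‖`. -/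
def CharFunModulus {d : ℕ} (f : LocScaleKernel d) (lmin lmax : ℝ) (Ξ : ℝ → ℝ) (p : ℝ) : Prop :=
  1 ≤ p ∧ IsGauge Ξ ∧ ∃ C > 0, ∀ ξ : Euc d,
    ∀ S ∈ boundedPosDef d lmin lmax, ∀ S' ∈ boundedPosDef d lmin lmax,
      ‖kernelCharFun f S' ξ - kernelCharFun f S ξ‖ ≤
        C * Ξ (symOpNorm (S - S')) * ‖ξ‖ ^ p *
          max ‖kernelCharFun f S' ξ‖ ‖kernelCharFun f S ξ‖

end

/-! Everything rests on the closed form Φ_Σ(ξ) = exp(-√(ξᵀΣξ)), `kernelCharFun_cauchyKernel`. The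
Cauchy density is a Gamma mixture of Gaussians, so its transform is an integral over the mixing
variable. Up to a power of π, that integral depends only on the norm of the frequency and not on the
dimension, so its value can be read off from the line. Super-smoothness and the modulus are then
elementary estimates.

For the L¹ bounds, ε = ‖p_G - p_G'‖₁ dominates |Φ_Σ φ_P - Φ_Σ' φ_P'| at every frequency
(`norm_charFun_sub_le_l1Dist`). Along a ray ξ = tv the scale acts at first order in t, while the
real part of the characteristic function of a measure on a ball differs from 1 only at order t².
Taking t proportional to the gap between √(vᵀΣv) and √(vᵀΣ'v) yields the quadratic scale bound
(`sq_sub_le_of_exp_mul_close`).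

By the modulus and the scale bound, exchanging Σ' for Σ costs O(ε^{1/4}‖ξ‖). Division by Φ_Σ then
gives |φ_P - φ_P'| ≲ ε^{1/4} e^{c‖ξ‖}. Smoothing at bandwidth h with a density whose characteristic
function has compact support, followed by an explicit coupling (`exists_coupling_of_kernel`), gives
W₁ ≲ h + h^{-d} ε^{1/4} e^{a/h}. Choosing h as a small multiple of W₁ turns this into the
exponential lower bound for ε. -/

/-! ### The Cauchy characteristic function on the line. -/

open Complex in
lemma integral_cexp_mul_I_mul_cexp_neg_abs (c : ℝ) :
    Integrable (fun x : ℝ => cexp ((c * x : ℝ) * I) * cexp (-(|x| : ℝ))) ∧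
    ∫ x : ℝ, cexp ((c * x : ℝ) * I) * cexp (-(|x| : ℝ)) = 2 / (1 + c ^ 2 : ℝ) := by
  set f : ℝ → ℂ := fun x : ℝ => cexp ((c * x : ℝ) * I) * cexp (-(|x| : ℝ)) with hf
  have e1 : Set.EqOn f (fun x : ℝ => cexp ((-1 + c * I) * x)) (Set.Ioi 0) := by
    intro x hx
    simp only [hf, ← Complex.exp_add, abs_of_pos (Set.mem_Ioi.1 hx)]
    congr 1; push_cast; ring
  have e2 : Set.EqOn f (fun x : ℝ => cexp ((1 + c * I) * x)) (Set.Iic 0) := by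
    intro x hx
    simp only [hf, ← Complex.exp_add, abs_of_nonpos (Set.mem_Iic.1 hx)]
    congr 1; push_cast; ring
  have h1 : (-1 + c * I).re < 0 := by simp
  have h2 : 0 < (1 + c * I).re := by simp
  have i1 : IntegrableOn f (Set.Ioi 0) :=
    (integrableOn_exp_mul_complex_Ioi h1 0).congr_fun e1.symm measurableSet_Ioi
  have i2 : IntegrableOn f (Set.Iic 0) :=
    (integrableOn_exp_mul_complex_Iic h2 0).congr_fun e2.symm measurableSet_Iic
  refine ⟨by rw [← integrableOn_univ, ← Set.Iic_union_Ioi (a := (0 : ℝ))]; exact i2.union i1, ?_⟩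
  rw [← intervalIntegral.integral_Iic_add_Ioi i2 i1, setIntegral_congr_fun measurableSet_Iic e2,
    setIntegral_congr_fun measurableSet_Ioi e1, integral_exp_mul_complex_Ioi h1,
    integral_exp_mul_complex_Iic h2]
  have h3 : (-1 + c * I) ≠ 0 := fun h => by simp [h] at h1
  have h4 : (1 + c * I) ≠ 0 := fun h => by simp [h] at h2
  have h5 : ((1 + c ^ 2 : ℝ) : ℂ) ≠ 0 := by
    rw [Complex.ofReal_ne_zero]; positivity
  simp only [Complex.ofReal_zero, mul_zero, Complex.exp_zero]
  field_simp
  push_cast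
  linear_combination (-2 * (c : ℂ) ^ 2) * Complex.I_sq

open Complex in
/-- The characteristic function of the standard Cauchy distribution on the line. -/
lemma integral_cexp_mul_inv_one_add_sq (t : ℝ) :
    ∫ x : ℝ, cexp ((x * t : ℝ) * I) * ((1 + x ^ 2)⁻¹ : ℝ) = Real.pi * Real.exp (-|t|) := by
  set f : ℝ → ℂ := fun x : ℝ => cexp (-(|x| : ℝ)) with hf
  have hF : FourierTransform.fourier f =
      fun w : ℝ => ((2 * (1 + (2 * Real.pi * w) ^ 2)⁻¹ : ℝ) : ℂ) := by
    ext w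
    have := (integral_cexp_mul_I_mul_cexp_neg_abs (-2 * Real.pi * w)).2
    rw [Real.fourier_real_eq_integral_exp_smul]
    simp only [smul_eq_mul, hf]
    rw [show (2 * (1 + (2 * Real.pi * w) ^ 2)⁻¹ : ℝ) = 2 / (1 + (-2 * Real.pi * w) ^ 2) by
      rw [div_eq_mul_inv]; congr 3; ring]
    rw [Complex.ofReal_div, Complex.ofReal_ofNat, ← this]
    congr 1; ext x; congr 4; ring
  have hc : Continuous f := by fun_prop
  have hi : Integrable f := by
    simpa using (integral_cexp_mul_I_mul_cexp_neg_abs 0).1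
  have hFi : Integrable (FourierTransform.fourier f) := by
    rw [hF]
    refine Integrable.ofReal (Integrable.const_mul ?_ 2)
    exact integrable_inv_one_add_sq.comp_mul_left' (by positivity : (2 * Real.pi : ℝ) ≠ 0)
  -- Fourier inversion is legitimate because the transform of e^{-|x|} is itself integrable; it
  -- exchanges the Laplace and Cauchy profiles.
  have key := congrFun (hc.fourierInv_fourier_eq hi hFi) t
  rw [Real.fourierInv_eq', hF] at key
  have := Measure.integral_comp_mul_left
    (fun x : ℝ => cexp ((x * t : ℝ) * I) * ((1 + x ^ 2)⁻¹ : ℝ)) (2 * Real.pi)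
  have h2 : ∫ v : ℝ, cexp ((2 * Real.pi * inner ℝ v t : ℝ) * I) •
        ((2 * (1 + (2 * Real.pi * v) ^ 2)⁻¹ : ℝ) : ℂ)
      = 2 * ∫ v : ℝ, cexp ((2 * Real.pi * v * t : ℝ) * I) *
          ((1 + (2 * Real.pi * v) ^ 2)⁻¹ : ℝ) := by
    rw [← integral_const_mul]
    congr 1; ext v
    simp only [smul_eq_mul, RCLike.inner_apply, conj_trivial, Complex.ofReal_mul]
    push_cast
    ring_nf
  rw [h2, this] at key
  simp only [hf] at key
  rw [abs_of_pos (by positivity), Complex.real_smul] at key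
  have hpi : (Real.pi : ℂ) ≠ 0 := by exact_mod_cast Real.pi_ne_zero
  push_cast at key ⊢
  rw [← key, ← mul_assoc, ← mul_assoc,
    show (Real.pi : ℂ) * 2 * (2 * (Real.pi : ℂ))⁻¹ = 1 by field_simp, one_mul]

/-! ### The Cauchy density as a Gamma mixture of Gaussians. -/

section GammaMixture

variable {V : Type*} [NormedAddCommGroup V] [InnerProductSpace ℝ V] [FiniteDimensional ℝ V]
  [MeasurableSpace V] [BorelSpace V]

lemma integrable_cauchy_profile :
    Integrable (fun x : V => (1 + ‖x‖ ^ 2) ^ (-(((Module.finrank ℝ V : ℝ) + 1) / 2))) := by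
  have := integrable_rpow_neg_one_add_norm_sq (E := V) (μ := volume)
    (r := (Module.finrank ℝ V : ℝ) + 1)
    (by linarith)
  simpa only [neg_div] using this

lemma integral_rpow_mul_exp_neg_one_add_mul {a q : ℝ} (ha : 0 < a) (hq : 0 ≤ q) :
    ∫ u in Set.Ioi (0 : ℝ), u ^ (a - 1) * Real.exp (-((1 + q) * u)) =
      Real.Gamma a * (1 + q) ^ (-a) := by
  rw [Real.integral_rpow_mul_exp_neg_mul_Ioi ha (by linarith), one_div, Real.inv_rpow (by linarith),
    Real.rpow_neg (by linarith), mul_comm]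

open Complex in
/-- The Cauchy profile is a Gamma mixture of Gaussians, so its characteristic function is an
integral of Gaussian characteristic functions. -/
lemma integral_cexp_inner_mul_cauchy_profile (ξ : V) :
    ∫ x : V, cexp ((inner ℝ ξ x : ℝ) * I) *
        ((Real.Gamma (((Module.finrank ℝ V : ℝ) + 1) / 2) *
          (1 + ‖x‖ ^ 2) ^ (-(((Module.finrank ℝ V : ℝ) + 1) / 2)) : ℝ) : ℂ) =
      (Real.pi ^ ((Module.finrank ℝ V : ℝ) / 2) * ∫ u in Set.Ioi (0 : ℝ),
        u ^ (-(1 / 2) : ℝ) * Real.exp (-u - ‖ξ‖ ^ 2 / (4 * u)) : ℝ) := by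
  set a : ℝ := ((Module.finrank ℝ V : ℝ) + 1) / 2 with ha
  have ha0 : 0 < a := by positivity
  set F : V → ℝ → ℂ := fun x u =>
    cexp ((inner ℝ ξ x : ℝ) * I) * ((u ^ (a - 1) * Real.exp (-((1 + ‖x‖ ^ 2) * u)) : ℝ) : ℂ)
    with hF
  have hnorm : ∀ x : V, ∀ u ∈ Set.Ioi (0 : ℝ),
      ‖F x u‖ = u ^ (a - 1) * Real.exp (-((1 + ‖x‖ ^ 2) * u)) := by
    intro x u hu
    have hu : 0 < u := hu
    simp only [hF]
    rw [norm_mul, Complex.norm_exp_ofReal_mul_I, one_mul, Complex.norm_real,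
      Real.norm_of_nonneg (by positivity)]
  -- Fubini applies since integrating ‖F‖ over u returns the Cauchy profile, which is integrable.
  have hint : Integrable (Function.uncurry F) (volume.prod (volume.restrict (Set.Ioi 0))) := by
    rw [integrable_prod_iff]
    · refine ⟨Filter.Eventually.of_forall fun x => ?_, ?_⟩
      · have h := (integrableOn_rpow_mul_exp_neg_mul_rpow (p := 1) (s := a - 1)
          (b := 1 + ‖x‖ ^ 2) (by linarith) one_pos (by positivity)).ofReal (𝕜 := ℂ)
        refine (h.const_mul (cexp ((inner ℝ ξ x : ℝ) * I))).congr
          (Filter.Eventually.of_forall fun u => ?_)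
        simp only [hF, Real.rpow_one, neg_mul]
        rfl
      · refine (integrable_cauchy_profile.const_mul (Real.Gamma a)).congr
          (Filter.Eventually.of_forall fun x => ?_)
        simp only [Function.uncurry]
        rw [setIntegral_congr_fun measurableSet_Ioi (hnorm x),
          integral_rpow_mul_exp_neg_one_add_mul ha0 (by positivity)]
    · refine Measurable.aestronglyMeasurable ?_
      simp only [hF, Function.uncurry_def]
      fun_prop
  have h1 : ∀ x : V, ∫ u in Set.Ioi (0 : ℝ), F x u =
      cexp ((inner ℝ ξ x : ℝ) * I) * ((Real.Gamma a * (1 + ‖x‖ ^ 2) ^ (-a) : ℝ) : ℂ) := by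
    intro x
    simp only [hF]
    rw [integral_const_mul, integral_complex_ofReal,
      integral_rpow_mul_exp_neg_one_add_mul ha0 (by positivity)]
  have h2 : ∀ u ∈ Set.Ioi (0 : ℝ), ∫ x : V, F x u =
      ((Real.pi ^ ((Module.finrank ℝ V : ℝ) / 2) *
        (u ^ (-(1 / 2) : ℝ) * Real.exp (-u - ‖ξ‖ ^ 2 / (4 * u))) : ℝ) : ℂ) := by
    intro u hu
    have hu : 0 < u := hu
    have e : ∀ x : V, F x u = ((u ^ (a - 1) * Real.exp (-u) : ℝ) : ℂ) *
        cexp (-(u : ℂ) * ‖x‖ ^ 2 + I * (inner ℝ ξ x : ℝ)) := by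
      intro x
      simp only [hF]
      push_cast
      rw [mul_left_comm, mul_assoc, ← Complex.exp_add, ← Complex.exp_add]
      congr 2; ring
    simp_rw [e]
    rw [integral_const_mul, GaussianFourier.integral_cexp_neg_mul_sq_norm_add (by simpa using hu)]
    have e2 : ((Real.pi : ℂ) / u) ^ ((Module.finrank ℝ V : ℂ) / 2) =
        (((Real.pi / u) ^ ((Module.finrank ℝ V : ℝ) / 2) : ℝ) : ℂ) := by
      rw [Complex.ofReal_cpow (by positivity)]; push_cast; rfl
    have e3 : cexp (I ^ 2 * ‖ξ‖ ^ 2 / (4 * u)) = ((Real.exp (-(‖ξ‖ ^ 2 / (4 * u))) : ℝ) : ℂ) := by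
      push_cast; rw [Complex.I_sq]; congr 1; ring
    rw [e2, e3, ← Complex.ofReal_mul, ← Complex.ofReal_mul]
    congr 1
    rw [Real.div_rpow (by positivity) hu.le, sub_eq_add_neg (-u), Real.exp_add]
    -- The Gaussian normalisation contributes u^{-n/2}, which cancels all dependence of the power of
    -- u on the dimension n.
    have : u ^ (a - 1) = u ^ (-(1 / 2) : ℝ) * u ^ ((Module.finrank ℝ V : ℝ) / 2) := by
      rw [← Real.rpow_add hu]; congr 1; rw [ha]; ring
    rw [this]
    have := (Real.rpow_pos_of_pos hu ((Module.finrank ℝ V : ℝ) / 2)).ne'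
    field_simp
  calc _ = ∫ x : V, ∫ u in Set.Ioi (0 : ℝ), F x u := by simp_rw [h1]
    _ = ∫ u in Set.Ioi (0 : ℝ), ∫ x : V, F x u := integral_integral_swap hint
    _ = _ := by
      rw [setIntegral_congr_fun measurableSet_Ioi h2, integral_complex_ofReal, integral_const_mul]

end GammaMixture

/-- In dimension one the mixture formula and Fourier inversion evaluate the same characteristic
function; comparing them gives the integral, which then serves in every dimension. -/
lemma integral_rpow_neg_half_mul_exp (s : ℝ) (hs : 0 ≤ s) :
    ∫ u in Set.Ioi (0 : ℝ), u ^ (-(1 / 2) : ℝ) * Real.exp (-u - s ^ 2 / (4 * u)) =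
      Real.sqrt Real.pi * Real.exp (-s) := by
  have h1 := integral_cexp_inner_mul_cauchy_profile (V := ℝ) s
  have h2 := integral_cexp_mul_inv_one_add_sq s
  simp only [Module.finrank_self, Nat.cast_one, RCLike.inner_apply, conj_trivial,
    show ((1 : ℝ) + 1) / 2 = 1 by norm_num, Real.Gamma_one, one_mul, Real.norm_eq_abs, sq_abs,
    Real.rpow_neg_one] at h1
  rw [h1, abs_of_nonneg hs, ← Complex.ofReal_mul, Complex.ofReal_inj, ← Real.sqrt_eq_rpow] at h2
  have h3 := Real.sqrt_pos.2 Real.pi_pos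
  refine mul_left_cancel₀ h3.ne' ?_
  rw [h2, ← mul_assoc, Real.mul_self_sqrt Real.pi_pos.le]

/-- The characteristic function of the standard Cauchy distribution on a Euclidean space. -/
lemma integral_cexp_inner_mul_cauchy {V : Type*} [NormedAddCommGroup V] [InnerProductSpace ℝ V]
    [FiniteDimensional ℝ V] [MeasurableSpace V] [BorelSpace V] (ξ : V) :
    ∫ x : V, Complex.exp ((inner ℝ ξ x : ℝ) * Complex.I) *
        ((Real.Gamma (((Module.finrank ℝ V : ℝ) + 1) / 2) *
          (1 + ‖x‖ ^ 2) ^ (-(((Module.finrank ℝ V : ℝ) + 1) / 2)) : ℝ) : ℂ) =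
      (Real.pi ^ (((Module.finrank ℝ V : ℝ) + 1) / 2) * Real.exp (-‖ξ‖) : ℝ) := by
  rw [integral_cexp_inner_mul_cauchy_profile, integral_rpow_neg_half_mul_exp _ (norm_nonneg _),
    ← mul_assoc, Real.sqrt_eq_rpow, ← Real.rpow_add Real.pi_pos, add_div]

/-! ### Quadratic forms and spectral bounds. -/

lemma quadForm_transpose_mul_self {d : ℕ} (B : Matrix (Fin d) (Fin d) ℝ) (v : Euc d) :
    quadForm (B.transpose * B) v = ‖Matrix.toEuclideanLin B v‖ ^ 2 := by
  rw [← real_inner_self_eq_norm_sq, EuclideanSpace.inner_eq_star_dotProduct, quadForm,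
    ← Matrix.mulVec_mulVec, Matrix.dotProduct_mulVec, Matrix.vecMul_transpose]
  rfl

lemma quadForm_sub {d : ℕ} (S T : Matrix (Fin d) (Fin d) ℝ) (v : Euc d) :
    quadForm (S - T) v = quadForm S v - quadForm T v := by
  simp [quadForm, Matrix.sub_mulVec, dotProduct_sub]

lemma quadForm_smul {d : ℕ} (S : Matrix (Fin d) (Fin d) ℝ) (t : ℝ) (v : Euc d) :
    quadForm S (t • v) = t ^ 2 * quadForm S v := by
  simp [quadForm, Matrix.mulVec_smul]
  ring

lemma quadForm_smul_one {d : ℕ} (c : ℝ) (v : Euc d) :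
    quadForm (c • (1 : Matrix (Fin d) (Fin d) ℝ)) v = c * ‖v‖ ^ 2 := by
  rw [← real_inner_self_eq_norm_sq, EuclideanSpace.inner_eq_star_dotProduct, quadForm,
    Matrix.smul_mulVec, Matrix.one_mulVec, dotProduct_smul, smul_eq_mul]
  rfl

lemma quadForm_nonneg {d : ℕ} {S : Matrix (Fin d) (Fin d) ℝ} (hS : S.PosSemidef) (v : Euc d) :
    0 ≤ quadForm S v := by
  simpa [quadForm] using hS.dotProduct_mulVec_nonneg v.ofLp

lemma continuous_quadForm {d : ℕ} (S : Matrix (Fin d) (Fin d) ℝ) :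
    Continuous (quadForm S) := by
  unfold quadForm
  fun_prop

open scoped MatrixOrder in
lemma exists_eq_transpose_mul_self {d : ℕ} {S : Matrix (Fin d) (Fin d) ℝ} (hS : S.PosDef) :
    ∃ B : Matrix (Fin d) (Fin d) ℝ, S = B.transpose * B ∧ B.det ≠ 0 := by
  obtain ⟨B, hB⟩ := CStarAlgebra.nonneg_iff_eq_star_mul_self.1 hS.posSemidef.nonneg
  rw [Matrix.star_eq_conjTranspose, Matrix.conjTranspose_eq_transpose_of_trivial] at hB
  refine ⟨B, hB, fun h => hS.det_pos.ne' ?_⟩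
  rw [hB, Matrix.det_mul, h, mul_zero]

/-- Shifting by a multiple of the identity shifts the spectrum, so S - lmin·1 and lmax·1 - S are
positive semidefinite. -/
lemma quadForm_bounds {d : ℕ} {lmin lmax : ℝ} {S : Matrix (Fin d) (Fin d) ℝ}
    (hS : S ∈ boundedPosDef d lmin lmax) (v : Euc d) :
    lmin * ‖v‖ ^ 2 ≤ quadForm S v ∧ quadForm S v ≤ lmax * ‖v‖ ^ 2 := by
  obtain ⟨hP, hb⟩ := hS
  have hh := hP.isHermitian
  have hone : ∀ c : ℝ, (c • (1 : Matrix (Fin d) (Fin d) ℝ)).IsHermitian := fun c => by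
    simp [Matrix.IsHermitian]
  have hspec : ∀ μ ∈ spectrum ℝ S, lmin ≤ μ ∧ μ ≤ lmax := by
    rw [hh.spectrum_real_eq_range_eigenvalues]
    rintro _ ⟨i, rfl⟩
    exact hb i
  have halg : ∀ c : ℝ, algebraMap ℝ (Matrix (Fin d) (Fin d) ℝ) c = c • 1 :=
    fun c => Algebra.algebraMap_eq_smul_one c
  constructor
  · have h1 : (S - lmin • (1 : Matrix (Fin d) (Fin d) ℝ)).IsHermitian := hh.sub (hone _)
    have h2 : (S - lmin • (1 : Matrix (Fin d) (Fin d) ℝ)).PosSemidef := by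
      rw [h1.posSemidef_iff_eigenvalues_nonneg]
      intro i
      have := h1.eigenvalues_mem_spectrum_real i
      generalize h1.eigenvalues i = e at this ⊢
      rw [← halg, ← spectrum.sub_singleton_eq, Set.sub_singleton] at this
      obtain ⟨μ, hμ, he⟩ := this
      simp only at he
      rw [← he]
      simpa using (hspec μ hμ).1
    have := quadForm_nonneg h2 v
    rw [quadForm_sub, quadForm_smul_one] at this
    linarith
  · have h1 : (lmax • (1 : Matrix (Fin d) (Fin d) ℝ) - S).IsHermitian := (hone _).sub hh
    have h2 : (lmax • (1 : Matrix (Fin d) (Fin d) ℝ) - S).PosSemidef := by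
      rw [h1.posSemidef_iff_eigenvalues_nonneg]
      intro i
      have := h1.eigenvalues_mem_spectrum_real i
      generalize h1.eigenvalues i = e at this ⊢
      rw [← halg, ← spectrum.singleton_sub_eq, Set.singleton_sub] at this
      obtain ⟨μ, hμ, he⟩ := this
      simp only at he
      rw [← he]
      simpa using (hspec μ hμ).2
    have := quadForm_nonneg h2 v
    rw [quadForm_sub, quadForm_smul_one] at this
    linarith

lemma bddAbove_range_abs_quadForm {d : ℕ} (S : Matrix (Fin d) (Fin d) ℝ) :
    BddAbove (Set.range fun v : Metric.closedBall (0 : Euc d) 1 => |quadForm S v|) := by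
  have := (isCompact_closedBall (0 : Euc d) 1).bddAbove_image
    (f := fun v => |quadForm S v|) (continuous_quadForm S).abs.continuousOn
  refine this.mono ?_
  rintro _ ⟨v, rfl⟩
  exact ⟨v, v.2, rfl⟩

lemma symOpNorm_nonneg {d : ℕ} (S : Matrix (Fin d) (Fin d) ℝ) : 0 ≤ symOpNorm S :=
  Real.iSup_nonneg fun _ => abs_nonneg _

lemma symOpNorm_le {d : ℕ} {S : Matrix (Fin d) (Fin d) ℝ} {c : ℝ}
    (h : ∀ v : Euc d, ‖v‖ ≤ 1 → |quadForm S v| ≤ c) : symOpNorm S ≤ c := by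
  have : Nonempty (Metric.closedBall (0 : Euc d) 1) := ⟨⟨0, by simp⟩⟩
  exact ciSup_le fun v => h v (mem_closedBall_zero_iff.1 v.2)

lemma abs_quadForm_le {d : ℕ} (S : Matrix (Fin d) (Fin d) ℝ) (v : Euc d) :
    |quadForm S v| ≤ symOpNorm S * ‖v‖ ^ 2 := by
  rcases eq_or_ne v 0 with rfl | hv
  · simp [quadForm]
  have hv' : ‖v‖ ≠ 0 := norm_ne_zero_iff.2 hv
  have h := le_ciSup (bddAbove_range_abs_quadForm S)
    ⟨‖v‖⁻¹ • v, by simp [norm_smul, hv']⟩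
  simp only [quadForm_smul, abs_mul, inv_pow, abs_inv, abs_pow, abs_norm] at h
  rw [inv_mul_le_iff₀ (by positivity)] at h
  rw [mul_comm]
  exact h

/-! ### Reduction to the standard kernel by a linear substitution. -/

section ChangeOfVariables

variable {d : ℕ} {S B : Matrix (Fin d) (Fin d) ℝ}

lemma det_toEuclideanLin (A : Matrix (Fin d) (Fin d) ℝ) :
    LinearMap.det (Matrix.toEuclideanLin A) = A.det := by
  rw [Matrix.toEuclideanLin_eq_toLin_orthonormal, LinearMap.det_toLin]

lemma integral_eq_abs_det_mul_integral_toEuclideanLin {F : Type*} [NormedAddCommGroup F]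
    [NormedSpace ℝ F] {A : Matrix (Fin d) (Fin d) ℝ} (hA : A.det ≠ 0) (g : Euc d → F) :
    ∫ x, g x = |A.det| • ∫ y, g (Matrix.toEuclideanLin A y) := by
  set T := Matrix.toEuclideanLin A
  have hdet : LinearMap.det T ≠ 0 := by rwa [det_toEuclideanLin]
  have hbij : Function.Bijective T := (LinearMap.equivOfDetNeZero T hdet).bijective
  have := integral_image_eq_integral_abs_det_fderiv_smul (volume : Measure (Euc d))
    (f := T) (f' := fun _ => LinearMap.toContinuousLinearMap T) MeasurableSet.univ
    (fun x _ => (LinearMap.toContinuousLinearMap T).hasFDerivWithinAt) hbij.injective.injOn g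
  rw [Set.image_univ, hbij.surjective.range_eq, setIntegral_univ, setIntegral_univ] at this
  rw [this, integral_smul]
  congr 2
  exact det_toEuclideanLin A

/-- With S = BᵀB, the substitution x = Bᵀy turns the form of S⁻¹ into the Euclidean norm, which
makes the kernel radial. -/
lemma quadForm_inv_toEuclideanLin (hB : B.det ≠ 0) (y : Euc d) :
    quadForm (B.transpose * B)⁻¹ (Matrix.toEuclideanLin B.transpose y) = ‖y‖ ^ 2 := by
  have hu : IsUnit B.det := isUnit_iff_ne_zero.2 hB
  have h1 : (B.transpose * B)⁻¹.mulVec (B.transpose.mulVec y.ofLp) = B⁻¹.mulVec y.ofLp := by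
    rw [Matrix.mul_inv_rev, Matrix.mulVec_mulVec, Matrix.mul_assoc, Matrix.nonsing_inv_mul _
      (by rwa [Matrix.det_transpose]), Matrix.mul_one]
  have h2 : (Matrix.toEuclideanLin B.transpose y).ofLp = B.transpose.mulVec y.ofLp := rfl
  rw [quadForm, h2, h1, ← real_inner_self_eq_norm_sq, EuclideanSpace.inner_eq_star_dotProduct,
    Matrix.mulVec_transpose, ← Matrix.dotProduct_mulVec, Matrix.mulVec_mulVec,
    Matrix.mul_nonsing_inv _ hu, Matrix.one_mulVec]
  rfl

lemma inner_toEuclideanLin_transpose (ξ y : Euc d) :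
    inner ℝ ξ (Matrix.toEuclideanLin B.transpose y) = inner ℝ (Matrix.toEuclideanLin B ξ) y := by
  rw [EuclideanSpace.inner_eq_star_dotProduct, EuclideanSpace.inner_eq_star_dotProduct]
  have h2 : (Matrix.toEuclideanLin B.transpose y).ofLp = B.transpose.mulVec y.ofLp := rfl
  have h3 : (Matrix.toEuclideanLin B ξ).ofLp = B.mulVec ξ.ofLp := rfl
  rw [h2, h3, star_trivial, star_trivial, Matrix.mulVec_transpose, Matrix.dotProduct_mulVec]

lemma cauchyKernel_toEuclideanLin (hB : B.det ≠ 0) (y : Euc d) :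
    cauchyKernel d (Matrix.toEuclideanLin B.transpose y) 0 (B.transpose * B) =
      (Real.pi ^ (((d : ℝ) + 1) / 2) * |B.det|)⁻¹ *
        (Real.Gamma (((d : ℝ) + 1) / 2) * (1 + ‖y‖ ^ 2) ^ (-(((d : ℝ) + 1) / 2))) := by
  rw [cauchyKernel, sub_zero, quadForm_inv_toEuclideanLin hB, Matrix.det_mul,
    Matrix.det_transpose, ← Real.sqrt_eq_rpow, Real.sqrt_mul_self_eq_abs, add_comm 1 (d : ℝ),
    Real.rpow_neg (by positivity), div_eq_mul_inv, mul_inv]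
  ring

end ChangeOfVariables

/-- The substitution x = Bᵀy moves the frequency from ξ to Bξ, and ‖Bξ‖² = ξᵀSξ. -/
lemma kernelCharFun_cauchyKernel {d : ℕ} {S : Matrix (Fin d) (Fin d) ℝ} (hS : S.PosDef)
    (ξ : Euc d) :
    kernelCharFun (cauchyKernel d) S ξ = (Real.exp (-Real.sqrt (quadForm S ξ)) : ℝ) := by
  obtain ⟨B, rfl, hB⟩ := exists_eq_transpose_mul_self hS
  have hBt : B.transpose.det ≠ 0 := by rwa [Matrix.det_transpose]
  have key := integral_cexp_inner_mul_cauchy (Matrix.toEuclideanLin B ξ)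
  rw [finrank_euclideanSpace_fin] at key
  rw [kernelCharFun, integral_eq_abs_det_mul_integral_toEuclideanLin hBt, Matrix.det_transpose,
    quadForm_transpose_mul_self, Real.sqrt_sq (norm_nonneg _)]
  simp_rw [cauchyKernel_toEuclideanLin hB, inner_toEuclideanLin_transpose, Complex.ofReal_mul
    (_ * _)⁻¹, mul_left_comm _ (((_ * _)⁻¹ : ℝ) : ℂ), mul_comm Complex.I]
  rw [integral_const_mul, key, ← Complex.ofReal_mul, Complex.real_smul, ← Complex.ofReal_mul]
  congr 1
  have h1 := abs_pos.2 hB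
  have h2 := Real.rpow_pos_of_pos Real.pi_pos (((d : ℝ) + 1) / 2)
  field_simp

lemma integral_cauchyKernel {d : ℕ} {S : Matrix (Fin d) (Fin d) ℝ} (hS : S.PosDef) :
    ∫ x, cauchyKernel d x 0 S = 1 := by
  have := kernelCharFun_cauchyKernel hS 0
  simp only [kernelCharFun, inner_zero_left, Complex.ofReal_zero, mul_zero, Complex.exp_zero,
    one_mul] at this
  rw [integral_complex_ofReal] at this
  simpa [quadForm] using this

/-- A non-integrable function would have Bochner integral 0, so total mass 1 already forces
integrability. -/
lemma integrable_cauchyKernel {d : ℕ} {S : Matrix (Fin d) (Fin d) ℝ} (hS : S.PosDef) :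
    Integrable (fun x => cauchyKernel d x 0 S) :=
  Integrable.of_integral_ne_zero (by rw [integral_cauchyKernel hS]; exact one_ne_zero)

lemma norm_kernelCharFun_cauchyKernel {d : ℕ} {S : Matrix (Fin d) (Fin d) ℝ} (hS : S.PosDef)
    (ξ : Euc d) :
    ‖kernelCharFun (cauchyKernel d) S ξ‖ = Real.exp (-Real.sqrt (quadForm S ξ)) := by
  rw [kernelCharFun_cauchyKernel hS, Complex.norm_real, Real.norm_of_nonneg (Real.exp_pos _).le]

/-! ### Super-smoothness and the modulus in the scale matrix. -/

lemma sqrt_quadForm_bounds {d : ℕ} {lmin lmax : ℝ} {S : Matrix (Fin d) (Fin d) ℝ}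
    (hS : S ∈ boundedPosDef d lmin lmax) (v : Euc d) :
    Real.sqrt lmin * ‖v‖ ≤ Real.sqrt (quadForm S v) ∧
      Real.sqrt (quadForm S v) ≤ Real.sqrt lmax * ‖v‖ := by
  have h := quadForm_bounds hS v
  constructor
  · refine (le_of_eq ?_).trans (Real.sqrt_le_sqrt h.1)
    rw [Real.sqrt_mul' _ (by positivity), Real.sqrt_sq (norm_nonneg _)]
  · refine (Real.sqrt_le_sqrt h.2).trans (le_of_eq ?_)
    rw [Real.sqrt_mul' _ (by positivity), Real.sqrt_sq (norm_nonneg _)]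

lemma isSuperSmooth_cauchyKernel (d : ℕ) {lmin lmax : ℝ} (hmin : 0 < lmin) (hlt : lmin < lmax) :
    IsSuperSmooth (cauchyKernel d) lmin lmax 1 := by
  refine ⟨one_pos, Real.sqrt lmax, Real.sqrt_pos.2 (hmin.trans hlt), Real.sqrt lmin,
    Real.sqrt_pos.2 hmin, fun ξ S hS => ?_⟩
  obtain ⟨hP, -⟩ := id hS
  have h := sqrt_quadForm_bounds hS ξ
  rw [norm_kernelCharFun_cauchyKernel hP, Real.rpow_one]
  constructor <;> apply Real.exp_le_exp.2 <;> linarith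

lemma abs_exp_neg_sub_exp_neg_le (a b : ℝ) :
    |Real.exp (-a) - Real.exp (-b)| ≤ |a - b| * max (Real.exp (-a)) (Real.exp (-b)) := by
  wlog h : a ≤ b generalizing a b
  · rw [abs_sub_comm, abs_sub_comm a, max_comm]
    exact this b a (le_of_not_ge h)
  have h1 : Real.exp (-b) ≤ Real.exp (-a) := Real.exp_le_exp.2 (by linarith)
  rw [max_eq_left h1, abs_of_nonneg (by linarith), abs_sub_comm, abs_of_nonneg (by linarith)]
  have h2 : Real.exp (-b) = Real.exp (-(b - a)) * Real.exp (-a) := by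
    rw [← Real.exp_add]; congr 1; ring
  have h3 := Real.add_one_le_exp (-(b - a))
  rw [h2]
  nlinarith [Real.exp_pos (-a)]

lemma abs_sqrt_sub_sqrt_le (a b : ℝ) (ha : 0 ≤ a) (hb : 0 ≤ b) :
    |Real.sqrt a - Real.sqrt b| ≤ Real.sqrt |a - b| := by
  apply Real.le_sqrt_of_sq_le
  wlog h : b ≤ a generalizing a b
  · rw [abs_sub_comm, abs_sub_comm a]
    exact this b a hb ha (le_of_not_ge h)
  have h1 := Real.sqrt_le_sqrt h
  rw [sq_abs, abs_of_nonneg (sub_nonneg.2 h)]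
  nlinarith [Real.sq_sqrt ha, Real.sq_sqrt hb, Real.sqrt_nonneg b]

lemma isGauge_sqrt : IsGauge Real.sqrt :=
  ⟨fun x _ => Real.sqrt_nonneg x, fun _ hx _ _ h => Real.sqrt_lt_sqrt hx h⟩

/-- The map a ↦ e^{-a} is Lipschitz relative to the larger value, and the square root is 1/2-Hölder
with constant 1. The latter is the source of the gauge √t. -/
lemma norm_kernelCharFun_cauchyKernel_sub_le {d : ℕ} {S S' : Matrix (Fin d) (Fin d) ℝ}
    (hS : S.PosDef) (hS' : S'.PosDef) (ξ : Euc d) :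
    ‖kernelCharFun (cauchyKernel d) S' ξ - kernelCharFun (cauchyKernel d) S ξ‖ ≤
      Real.sqrt (symOpNorm (S - S')) * ‖ξ‖ *
        max ‖kernelCharFun (cauchyKernel d) S' ξ‖ ‖kernelCharFun (cauchyKernel d) S ξ‖ := by
  rw [norm_kernelCharFun_cauchyKernel hS, norm_kernelCharFun_cauchyKernel hS',
    kernelCharFun_cauchyKernel hS, kernelCharFun_cauchyKernel hS', ← Complex.ofReal_sub,
    Complex.norm_real, Real.norm_eq_abs]
  refine (abs_exp_neg_sub_exp_neg_le _ _).trans ?_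
  gcongr
  refine (abs_sqrt_sub_sqrt_le _ _ (quadForm_nonneg hS'.posSemidef ξ)
    (quadForm_nonneg hS.posSemidef ξ)).trans ?_
  rw [abs_sub_comm, ← quadForm_sub]
  refine (Real.sqrt_le_sqrt (abs_quadForm_le _ ξ)).trans (le_of_eq ?_)
  rw [Real.sqrt_mul' _ (by positivity), Real.sqrt_sq (norm_nonneg _)]

lemma charFunModulus_cauchyKernel (d : ℕ) (lmin lmax : ℝ) :
    CharFunModulus (cauchyKernel d) lmin lmax Real.sqrt 1 := by
  refine ⟨le_rfl, isGauge_sqrt, 1, one_pos, fun ξ S hS S' hS' => ?_⟩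
  rw [one_mul, Real.rpow_one]
  exact norm_kernelCharFun_cauchyKernel_sub_le hS.1 hS'.1 ξ

/-! ### Characteristic functions of mixtures and the L¹ distance. -/

section MixtureCharFun

variable {d : ℕ} {S : Matrix (Fin d) (Fin d) ℝ}

lemma cauchyKernel_eq_sub (x θ : Euc d) (S : Matrix (Fin d) (Fin d) ℝ) :
    cauchyKernel d x θ S = cauchyKernel d (x - θ) 0 S := by
  simp [cauchyKernel]

lemma integrable_cauchyKernel_prod (hS : S.PosDef) (P : Measure (Euc d)) [IsProbabilityMeasure P] :
    Integrable (fun p : Euc d × Euc d => cauchyKernel d p.1 p.2 S) (volume.prod P) := by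
  -- The mixture is the convolution of the kernel with P; the constant 1 is the density of P
  -- relative to itself.
  have := (integrable_const (μ := P) (1 : ℝ)).convolution_integrand
    (ContinuousLinearMap.mul ℝ ℝ) (integrable_cauchyKernel hS)
  simp only [ContinuousLinearMap.mul_apply', one_mul] at this
  exact this.congr (Filter.Eventually.of_forall fun p => (cauchyKernel_eq_sub p.1 p.2 S).symm)

lemma integrable_mixtureDensity (hS : S.PosDef) (P : ProbabilityMeasure (Euc d)) :
    Integrable (mixtureDensity (cauchyKernel d) (P, S)) :=
  (integrable_cauchyKernel_prod hS P).integral_prod_left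

lemma norm_cexp_I_mul (r : ℝ) : ‖Complex.exp (Complex.I * r)‖ = 1 := by
  rw [mul_comm, Complex.norm_exp_ofReal_mul_I]

/-- A location mixture is a convolution, so its characteristic function is a product. -/
lemma integral_cexp_mul_mixtureDensity (hS : S.PosDef) (P : ProbabilityMeasure (Euc d))
    (ξ : Euc d) :
    ∫ x : Euc d, Complex.exp (Complex.I * (inner ℝ ξ x : ℝ)) *
        (mixtureDensity (cauchyKernel d) (P, S) x : ℂ) =
      kernelCharFun (cauchyKernel d) S ξ * charFun (P : Measure (Euc d)) ξ := by
  set e : Euc d → ℂ := fun x => Complex.exp (Complex.I * (inner ℝ ξ x : ℝ)) with he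
  have hadd : ∀ x y, e (x + y) = e x * e y := by
    intro x y
    simp only [he, inner_add_right, ← Complex.exp_add]
    congr 1; push_cast; ring
  have hint : Integrable (Function.uncurry fun x θ : Euc d =>
      e x * (cauchyKernel d x θ S : ℂ)) (volume.prod (P : Measure (Euc d))) := by
    refine Integrable.bdd_mul (c := 1) (integrable_cauchyKernel_prod hS P).ofReal ?_ ?_
    · refine Continuous.aestronglyMeasurable ?_
      simp only [he]
      fun_prop
    · exact Filter.Eventually.of_forall fun p => (norm_cexp_I_mul _).le
  calc _ = ∫ x : Euc d, ∫ θ, e x * (cauchyKernel d x θ S : ℂ) ∂(P : Measure (Euc d)) := by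
        congr 1; ext x
        rw [integral_const_mul, integral_complex_ofReal]; rfl
    _ = ∫ θ, (∫ x : Euc d, e x * (cauchyKernel d x θ S : ℂ)) ∂(P : Measure (Euc d)) :=
        integral_integral_swap hint
    _ = ∫ θ, e θ * kernelCharFun (cauchyKernel d) S ξ ∂(P : Measure (Euc d)) := by
        congr 1; ext θ
        rw [kernelCharFun, ← integral_const_mul, ← integral_add_right_eq_self _ θ]
        congr 1; ext x
        rw [cauchyKernel_eq_sub, add_sub_cancel_right, hadd]
        simp only [he]
        ring
    _ = _ := by
        rw [integral_mul_const, mul_comm, charFun_apply]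
        congr 2; ext θ
        simp only [he]
        rw [real_inner_comm, mul_comm]

/-- The Fourier transform is a contraction from L¹ to the sup norm. All lower bounds on the L¹
distance pass through this inequality. -/
lemma norm_charFun_sub_le_l1Dist {S' : Matrix (Fin d) (Fin d) ℝ} (hS : S.PosDef) (hS' : S'.PosDef)
    (P P' : ProbabilityMeasure (Euc d)) (ξ : Euc d) :
    ‖kernelCharFun (cauchyKernel d) S ξ * charFun (P : Measure (Euc d)) ξ -
        kernelCharFun (cauchyKernel d) S' ξ * charFun (P' : Measure (Euc d)) ξ‖ ≤
      l1Dist (mixtureDensity (cauchyKernel d) (P, S))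
        (mixtureDensity (cauchyKernel d) (P', S')) := by
  have hm : ∀ f : Euc d → ℝ, Integrable f → Integrable
      (fun x : Euc d => Complex.exp (Complex.I * (inner ℝ ξ x : ℝ)) * (f x : ℂ)) := by
    intro f hf
    refine Integrable.bdd_mul (c := 1) hf.ofReal (Continuous.aestronglyMeasurable (by fun_prop)) ?_
    exact Filter.Eventually.of_forall fun p => (norm_cexp_I_mul _).le
  rw [← integral_cexp_mul_mixtureDensity hS, ← integral_cexp_mul_mixtureDensity hS',
    ← integral_sub (hm _ (integrable_mixtureDensity hS P))
      (hm _ (integrable_mixtureDensity hS' P'))]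
  refine (norm_integral_le_integral_norm _).trans (le_of_eq ?_)
  unfold l1Dist
  congr 1; ext x
  rw [← mul_sub, norm_mul, norm_cexp_I_mul, one_mul, ← Complex.ofReal_sub, Complex.norm_real,
    Real.norm_eq_abs]

lemma l1Dist_nonneg (p q : Euc d → ℝ) : 0 ≤ l1Dist p q :=
  integral_nonneg fun _ => abs_nonneg _

end MixtureCharFun

/-! ### Identifiability of the scale. -/

lemma ae_norm_le_of_support_subset {d : ℕ} {X : Set (Euc d)} {R : ℝ} {P : Measure (Euc d)}
    (hP : P.support ⊆ X) (hX : X ⊆ Metric.closedBall 0 R) : ∀ᵐ x ∂P, ‖x‖ ≤ R := by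
  filter_upwards [Measure.support_mem_ae (μ := P)] with x hx
  exact mem_closedBall_zero_iff.1 (hX (hP hx))

/-- From cos x ≥ 1 - x²/2. Only the real part is used because the mean of P can move the imaginary
part at first order. -/
lemma one_sub_le_re_charFun {d : ℕ} {R : ℝ} (hR : 0 ≤ R) (P : Measure (Euc d))
    [IsProbabilityMeasure P] (hP : ∀ᵐ x ∂P, ‖x‖ ≤ R) (ξ : Euc d) :
    1 - R ^ 2 * ‖ξ‖ ^ 2 / 2 ≤ (charFun P ξ).re := by
  have hi : Integrable (fun x => Complex.exp ((inner ℝ x ξ : ℝ) * Complex.I)) P := by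
    refine Integrable.of_bound (C := 1) (Continuous.aestronglyMeasurable (by fun_prop)) ?_
    exact Filter.Eventually.of_forall fun x => (Complex.norm_exp_ofReal_mul_I _).le
  have h1 : (charFun P ξ).re = ∫ x, Real.cos (inner ℝ x ξ) ∂P := by
    rw [charFun_apply]
    have := integral_re hi
    simp only [RCLike.re_to_complex] at this
    rw [← this]
    simp only [Complex.exp_ofReal_mul_I_re]
  have h2 : Integrable (fun x => Real.cos (inner ℝ x ξ)) P := by
    have := hi.re
    simpa only [RCLike.re_to_complex, Complex.exp_ofReal_mul_I_re] using this
  rw [h1]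
  calc 1 - R ^ 2 * ‖ξ‖ ^ 2 / 2 = ∫ _, (1 - R ^ 2 * ‖ξ‖ ^ 2 / 2) ∂P := by simp
    _ ≤ _ := by
      refine integral_mono_ae (integrable_const _) h2 ?_
      filter_upwards [hP] with x hx
      refine le_trans ?_ Real.one_sub_sq_div_two_le_cos
      have : (inner ℝ x ξ : ℝ) ^ 2 ≤ (R * ‖ξ‖) ^ 2 := by
        rw [sq_le_sq, abs_of_nonneg (mul_nonneg hR (norm_nonneg ξ))]
        exact (abs_real_inner_le_norm x ξ).trans (by gcongr)
      nlinarith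

lemma exp_neg_mul_sub_exp_neg_mul_ge (s s' t : ℝ) :
    (s - s') * t * Real.exp (-(s * t)) ≤ Real.exp (-(s' * t)) - Real.exp (-(s * t)) := by
  have h2 : Real.exp (-(s' * t)) = Real.exp ((s - s') * t) * Real.exp (-(s * t)) := by
    rw [← Real.exp_add]; congr 1; ring
  have h3 := Real.add_one_le_exp ((s - s') * t)
  rw [h2]
  nlinarith [Real.exp_pos (-(s * t))]

/-- If `e^{-s t} φ(t)` and `e^{-s' t} φ'(t)` are `ε`-close for every `t ≥ 0`, where `φ, φ'` are
within `R² t² / 2` of `1`, then `s` and `s'` are `O(√ε)`-close. -/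
lemma sq_sub_le_of_exp_mul_close {R L ε s s' : ℝ} (hR : 0 < R) (hs : 0 ≤ s) (hs' : 0 ≤ s')
    (hsL : s ≤ L) (hsL' : s' ≤ L) {φ φ' : ℝ → ℂ} (hφ : ∀ t, ‖φ t‖ ≤ 1) (hφ' : ∀ t, ‖φ' t‖ ≤ 1)
    (hr : ∀ t, 1 - R ^ 2 * t ^ 2 / 2 ≤ (φ t).re) (hr' : ∀ t, 1 - R ^ 2 * t ^ 2 / 2 ≤ (φ' t).re)
    (h : ∀ t, 0 ≤ t →
      ‖(Real.exp (-(s * t)) : ℂ) * φ t - (Real.exp (-(s' * t)) : ℂ) * φ' t‖ ≤ ε) :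
    Real.exp (-1) ^ 2 / (2 * (R ^ 2 + L ^ 2)) * (s - s') ^ 2 ≤ ε := by
  wlog hss : s' ≤ s generalizing s s' φ φ'
  · have := this hs' hs hsL' hsL hφ' hφ hr' hr
      (fun t h0 => by rw [norm_sub_rev]; exact h t h0) (le_of_not_ge hss)
    rwa [← neg_sub s s', neg_sq] at this
  set E := Real.exp (-1) with hE
  have hE0 : 0 < E := Real.exp_pos _
  have hE1 : E ≤ 1 := Real.exp_le_one_iff.2 (by norm_num)
  have hL : 0 ≤ L := hs.trans hsL
  have hD : 0 < R ^ 2 + L ^ 2 := by positivity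
  -- The gain in the scale is (s - s')tE and the loss from the mixing measures is R²t²/2. For t =
  -- c(s - s'), the bound cR² ≤ E makes the loss at most half the gain, and cL² ≤ E ≤ 1 keeps st ≤
  -- 1, hence e^{-st} ≥ E.
  set c := E / (R ^ 2 + L ^ 2) with hc
  have hc0 : 0 < c := by positivity
  have hcD : c * (R ^ 2 + L ^ 2) = E := div_mul_cancel₀ _ hD.ne'
  set t := c * (s - s') with ht
  have hΔ : 0 ≤ s - s' := by linarith
  have ht0 : 0 ≤ t := by positivity
  have h1 := (Complex.abs_re_le_norm _).trans (h t ht0)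
  rw [Complex.sub_re, Complex.re_ofReal_mul, Complex.re_ofReal_mul] at h1
  -- The sign puts the slower decay e^{-s't} in front, so φ' is needed only from below and φ only
  -- through Re φ ≤ 1.
  have h2 := (neg_le_abs _).trans h1
  have h3 : Real.exp (-(s * t)) * (φ t).re ≤ Real.exp (-(s * t)) :=
    mul_le_of_le_one_right (Real.exp_pos _).le
      ((le_abs_self _).trans ((Complex.abs_re_le_norm _).trans (hφ t)))
  have h4 : Real.exp (-(s' * t)) * (1 - R ^ 2 * t ^ 2 / 2) ≤ Real.exp (-(s' * t)) * (φ' t).re :=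
    mul_le_mul_of_nonneg_left (hr' t) (Real.exp_pos _).le
  have h5 : Real.exp (-(s' * t)) ≤ 1 := Real.exp_le_one_iff.2 (by
    have := mul_nonneg hs' ht0; linarith)
  have h6 := exp_neg_mul_sub_exp_neg_mul_ge s s' t
  have h7 : E ≤ Real.exp (-(s * t)) := by
    apply Real.exp_le_exp.2
    have : s * t ≤ 1 := by
      have a1 : s * (s - s') ≤ L * L := by
        apply mul_le_mul hsL (by linarith) hΔ hL
      have a2 : c * (L * L) ≤ E := by rw [← hcD]; gcongr; nlinarith
      calc s * t = c * (s * (s - s')) := by rw [ht]; ring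
        _ ≤ c * (L * L) := by gcongr
        _ ≤ 1 := a2.trans hE1
    linarith
  have h8 : (s - s') * t * E ≤ (s - s') * t * Real.exp (-(s * t)) := by gcongr
  have h9 : Real.exp (-(s' * t)) * (R ^ 2 * t ^ 2 / 2) ≤ R ^ 2 * t ^ 2 / 2 :=
    mul_le_of_le_one_left (by positivity) h5
  have h10 : R ^ 2 * t ^ 2 / 2 ≤ (s - s') * t * E / 2 := by
    have : R ^ 2 * c ≤ E := by rw [← hcD, mul_comm]; gcongr; nlinarith
    have : R ^ 2 * t ^ 2 = (R ^ 2 * c) * ((s - s') * t) := by rw [ht]; ring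
    rw [this, mul_comm _ E]
    gcongr
  have h11 : E ^ 2 / (2 * (R ^ 2 + L ^ 2)) * (s - s') ^ 2 = (s - s') * t * E / 2 := by
    rw [ht, hc]; field_simp
  rw [h11]
  linarith

lemma isGauge_sq : IsGauge (fun t : ℝ => t ^ 2) :=
  ⟨fun x _ => sq_nonneg x, fun _ hx _ _ h => pow_lt_pow_left₀ h hx two_ne_zero⟩

lemma scaleLowerBound_cauchyKernel (d : ℕ) {R lmin lmax : ℝ} (hR : 0 < R) (hmax : 0 < lmax) :
    ScaleLowerBound (cauchyKernel d) R lmin lmax (fun t => t ^ 2) := by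
  set L := Real.sqrt lmax with hL
  have hL0 : 0 < L := Real.sqrt_pos.2 hmax
  set C := Real.exp (-1) ^ 2 / (2 * (R ^ 2 + L ^ 2)) with hC
  have hC0 : 0 < C := by positivity
  -- The scalar lemma controls a difference of square roots; multiplying by s + s' ≤ 2L recovers the
  -- quadratic forms at the price of 4L².
  refine ⟨isGauge_sq, C / (4 * L ^ 2), by positivity, ?_⟩
  rintro X - hX ⟨P, S⟩ ⟨hP, hS⟩ ⟨P', S'⟩ ⟨hP', hS'⟩
  dsimp only at hP hS hP' hS' ⊢
  set ε := l1Dist (mixtureDensity (cauchyKernel d) (P, S))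
    (mixtureDensity (cauchyKernel d) (P', S'))
  have haP := ae_norm_le_of_support_subset hP hX
  have haP' := ae_norm_le_of_support_subset hP' hX
  have hε : 0 ≤ ε := l1Dist_nonneg _ _
  have key : symOpNorm (S - S') ≤ Real.sqrt (ε / (C / (4 * L ^ 2))) := by
    refine symOpNorm_le fun v hv => Real.le_sqrt_of_sq_le ?_
    rw [sq_abs, le_div_iff₀ (by positivity), quadForm_sub]
    have hq := quadForm_nonneg hS.1.posSemidef v
    have hq' := quadForm_nonneg hS'.1.posSemidef v
    set s := Real.sqrt (quadForm S v) with hs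
    set s' := Real.sqrt (quadForm S' v) with hs'
    have hsL : s ≤ L := (sqrt_quadForm_bounds hS v).2.trans (mul_le_of_le_one_right hL0.le hv)
    have hsL' : s' ≤ L := (sqrt_quadForm_bounds hS' v).2.trans (mul_le_of_le_one_right hL0.le hv)
    have hs0 : 0 ≤ s := Real.sqrt_nonneg _
    have hs0' : 0 ≤ s' := Real.sqrt_nonneg _
    have hre : ∀ Q : ProbabilityMeasure (Euc d), (∀ᵐ x ∂(Q : Measure (Euc d)), ‖x‖ ≤ R) → ∀ t : ℝ,
        1 - R ^ 2 * t ^ 2 / 2 ≤ (charFun (Q : Measure (Euc d)) (t • v)).re := by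
      intro Q hQ t
      refine le_trans ?_ (one_sub_le_re_charFun hR.le Q hQ (t • v))
      have : ‖t • v‖ ^ 2 ≤ t ^ 2 := by
        rw [norm_smul, mul_pow, Real.norm_eq_abs, sq_abs]
        exact mul_le_of_le_one_right (sq_nonneg t) (pow_le_one₀ (norm_nonneg v) hv)
      gcongr
    have hsq : ∀ T : Matrix (Fin d) (Fin d) ℝ, T.PosDef → ∀ t : ℝ, 0 ≤ t →
        kernelCharFun (cauchyKernel d) T (t • v) =
          (Real.exp (-(Real.sqrt (quadForm T v) * t)) : ℂ) := by
      intro T hT t ht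
      rw [kernelCharFun_cauchyKernel hT, quadForm_smul, Real.sqrt_mul (sq_nonneg t),
        Real.sqrt_sq ht, mul_comm t]
    -- On the ray t ↦ tv with t ≥ 0 the kernel's characteristic function is the pure exponential
    -- e^{-st}.
    have h1 := sq_sub_le_of_exp_mul_close hR hs0 hs0' hsL hsL'
      (φ := fun t => charFun (P : Measure (Euc d)) (t • v))
      (φ' := fun t => charFun (P' : Measure (Euc d)) (t • v))
      (fun t => norm_charFun_le_one _) (fun t => norm_charFun_le_one _) (hre P haP) (hre P' haP')
      (ε := ε) (fun t ht => by
        have := norm_charFun_sub_le_l1Dist hS.1 hS'.1 P P' (t • v)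
        rwa [hsq S hS.1 t ht, hsq S' hS'.1 t ht] at this)
    rw [← hC] at h1
    have h2 : quadForm S v - quadForm S' v = (s + s') * (s - s') := by
      rw [← sq_sub_sq, hs, hs', Real.sq_sqrt hq, Real.sq_sqrt hq']
    rw [h2]
    have h3 : (s + s') ^ 2 ≤ 4 * L ^ 2 := by nlinarith
    calc ((s + s') * (s - s')) ^ 2 * (C / (4 * L ^ 2))
        = (C * (s - s') ^ 2) * ((s + s') ^ 2 / (4 * L ^ 2)) := by ring
      _ ≤ (C * (s - s') ^ 2) * 1 := by
          gcongr
          rw [div_le_one (by positivity)]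
          exact h3
      _ ≤ ε := by rw [mul_one]; exact h1
  have h4 : symOpNorm (S - S') ^ 2 ≤ ε / (C / (4 * L ^ 2)) := by
    rw [← Real.sq_sqrt (x := ε / (C / (4 * L ^ 2))) (by positivity)]
    exact pow_le_pow_left₀ (symOpNorm_nonneg _) key 2
  rw [le_div_iff₀ (by positivity)] at h4
  linarith

/-! ### A coupling built from smoothed measures. -/

section Coupling

open scoped ENNReal

lemma map_fst_withDensity_prod {α β : Type*} [MeasurableSpace α] [MeasurableSpace β]
    {P : Measure α} {Q : Measure β} [SFinite P] [SFinite Q] {h : α × β → ℝ≥0∞}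
    (hm : Measurable h) (h1 : ∀ᵐ x ∂P, ∫⁻ y, h (x, y) ∂Q = 1) :
    ((P.prod Q).withDensity h).map Prod.fst = P := by
  ext s hs
  rw [Measure.map_apply measurable_fst hs, withDensity_apply _ (measurable_fst hs),
    ← Set.prod_univ, ← Measure.prod_restrict, lintegral_prod _ hm.aemeasurable,
    Measure.restrict_univ, lintegral_congr_ae (ae_restrict_of_ae h1)]
  simp

lemma map_snd_withDensity_prod {α β : Type*} [MeasurableSpace α] [MeasurableSpace β]
    {P : Measure α} {Q : Measure β} [SFinite P] [SFinite Q] {h : α × β → ℝ≥0∞}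
    (hm : Measurable h) (h1 : ∀ᵐ y ∂Q, ∫⁻ x, h (x, y) ∂P = 1) :
    ((P.prod Q).withDensity h).map Prod.snd = Q := by
  ext s hs
  rw [Measure.map_apply measurable_snd hs, withDensity_apply _ (measurable_snd hs),
    ← Set.univ_prod, ← Measure.prod_restrict, lintegral_prod_symm _ hm.aemeasurable,
    Measure.restrict_univ, lintegral_congr_ae (ae_restrict_of_ae h1)]
  simp

/-- The quotient is the gluing weight of the coupling. Where p or p' vanishes so does the numerator,
and 0/0 = 0 in `ℝ≥0∞`. -/
lemma min_div_mul_mul_le_one {p p' : ℝ≥0∞} (hp : p ≠ ⊤) (hp' : p' ≠ ⊤) :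
    min p p' / (p * p') * p' ≤ 1 := by
  rcases eq_or_ne p 0 with rfl | h0
  · simp
  rcases eq_or_ne p' 0 with rfl | h0'
  · simp
  rw [mul_comm, ← mul_div_assoc, mul_comm p p', ENNReal.mul_div_mul_left _ _ h0' hp']
  exact ENNReal.div_le_of_le_mul (by simp)

lemma mul_min_div_mul_mul {p p' : ℝ≥0∞} (hp : p ≠ ⊤) (hp' : p' ≠ ⊤) :
    p * (min p p' / (p * p') * p') = min p p' := by
  rcases eq_or_ne p 0 with rfl | h0
  · simp
  rcases eq_or_ne p' 0 with rfl | h0'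
  · simp
  rw [mul_comm _ p', ← mul_assoc]
  exact ENNReal.mul_div_cancel (mul_ne_zero h0 h0') (ENNReal.mul_ne_top hp hp')

/-- Transporting through an intermediate point `y` costs at most twice the mean displacement. -/
lemma lintegral_edist_mul_lintegral_le {d : ℕ} (P P' : Measure (Euc d)) [IsProbabilityMeasure P]
    [IsProbabilityMeasure P'] {k : Euc d → Euc d → ℝ≥0∞} (hk : Measurable (Function.uncurry k))
    {M : ℝ≥0∞} (hM : ∀ x, ∫⁻ y, edist x y * k x y ≤ M) {q : Euc d → ℝ≥0∞} (hqm : Measurable q)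
    (hr : ∀ y, q y * ∫⁻ x, k x y ∂P' ≤ 1) (hr' : ∀ y, q y * ∫⁻ x, k x y ∂P ≤ 1) :
    ∫⁻ z, edist z.1 z.2 * (∫⁻ y, k z.1 y * k z.2 y * q y) ∂P.prod P' ≤ 2 * M := by
  have hkr : ∀ y, Measurable fun x => k x y := fun y => hk.comp measurable_prodMk_right
  have hqt : ∀ y, Measurable fun x => k x y * q y := fun y => (hkr y).mul_const _
  have hkk : Measurable fun w : (Euc d × Euc d) × Euc d => k w.1.1 w.2 * k w.1.2 w.2 * q w.2 :=
    ((hk.comp (by fun_prop : Measurable fun w : (Euc d × Euc d) × Euc d => (w.1.1, w.2))).mul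
      (hk.comp (by fun_prop : Measurable fun w : (Euc d × Euc d) × Euc d => (w.1.2, w.2)))).mul
      (hqm.comp measurable_snd)
  have hf1 : Measurable fun w : (Euc d × Euc d) × Euc d =>
      edist w.1.1 w.2 * (k w.1.1 w.2 * k w.1.2 w.2 * q w.2) :=
    Measurable.mul (by fun_prop) hkk
  have hf2 : Measurable fun w : (Euc d × Euc d) × Euc d =>
      edist w.1.2 w.2 * (k w.1.1 w.2 * k w.1.2 w.2 * q w.2) :=
    Measurable.mul (by fun_prop) hkk
  have hsplit : ∫⁻ z, edist z.1 z.2 * (∫⁻ y, k z.1 y * k z.2 y * q y) ∂P.prod P' ≤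
      (∫⁻ z, (∫⁻ y, edist z.1 y * (k z.1 y * k z.2 y * q y)) ∂P.prod P') +
        ∫⁻ z, (∫⁻ y, edist z.2 y * (k z.1 y * k z.2 y * q y)) ∂P.prod P' := by
    have hf1' : Measurable fun z : Euc d × Euc d =>
        ∫⁻ y, edist z.1 y * (k z.1 y * k z.2 y * q y) := hf1.lintegral_prod_right'
    rw [← lintegral_add_left hf1']
    refine lintegral_mono fun z => ?_
    have hm1 : Measurable fun y => k z.1 y * k z.2 y * q y := hkk.comp measurable_prodMk_left
    have hm2 : Measurable fun y => edist z.1 y * (k z.1 y * k z.2 y * q y) :=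
      Measurable.mul (by fun_prop) hm1
    calc _ = ∫⁻ y, edist z.1 z.2 * (k z.1 y * k z.2 y * q y) := (lintegral_const_mul _ hm1).symm
      _ ≤ ∫⁻ y, (edist z.1 y * (k z.1 y * k z.2 y * q y) +
          edist z.2 y * (k z.1 y * k z.2 y * q y)) := by
        refine lintegral_mono fun y => ?_
        rw [← add_mul]
        exact mul_le_mul' (edist_triangle_right _ _ _) le_rfl
      _ = _ := lintegral_add_left hm2 _
  -- Integrating out x' first, the weight q absorbs its total mass at y with a factor at most 1,
  -- leaving the mean displacement of x alone.
  have hT1 : (∫⁻ z, (∫⁻ y, edist z.1 y * (k z.1 y * k z.2 y * q y)) ∂P.prod P') ≤ M := by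
    rw [lintegral_prod _ hf1.lintegral_prod_right'.aemeasurable]
    calc _ ≤ ∫⁻ _, M ∂P := by
          refine lintegral_mono fun x => ?_
          dsimp only
          rw [lintegral_lintegral_swap]
          · refine (lintegral_mono fun y => ?_).trans (hM x)
            simp_rw [mul_assoc]
            rw [lintegral_const_mul _ (by fun_prop (disch := assumption)),
              lintegral_const_mul _ (hqt y), lintegral_mul_const _ (hkr y), mul_comm _ (q y)]
            gcongr
            exact mul_le_of_le_one_right' (hr y)
          · exact (hf1.comp (by fun_prop :
              Measurable fun w : Euc d × Euc d => ((x, w.1), w.2))).aemeasurable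
      _ = M := by simp
  have hT2 : (∫⁻ z, (∫⁻ y, edist z.2 y * (k z.1 y * k z.2 y * q y)) ∂P.prod P') ≤ M := by
    rw [lintegral_prod_symm _ hf2.lintegral_prod_right'.aemeasurable]
    calc _ ≤ ∫⁻ _, M ∂P' := by
          refine lintegral_mono fun x' => ?_
          dsimp only
          rw [lintegral_lintegral_swap]
          · refine (lintegral_mono fun y => ?_).trans (hM x')
            have e : ∀ x, edist x' y * (k x y * k x' y * q y) =
                edist x' y * k x' y * q y * k x y := fun x => by ring
            simp_rw [e]
            rw [lintegral_const_mul _ (hkr y), mul_assoc _ (q y)]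
            exact mul_le_of_le_one_right' (hr' y)
          · exact (hf2.comp (by fun_prop :
              Measurable fun w : Euc d × Euc d => ((w.1, x'), w.2))).aemeasurable
      _ = M := by simp
  rw [two_mul]
  exact hsplit.trans (add_le_add hT1 hT2)

/-- Two probability measures that are close after smoothing by a Markov density `k` have a
coupling of small transport cost: the common part of the smoothed measures is transported through
the intermediate point, and the rest is coupled independently. -/
theorem exists_coupling_of_kernel {d : ℕ} (P P' : Measure (Euc d)) [IsProbabilityMeasure P]
    [IsProbabilityMeasure P'] {k : Euc d → Euc d → ℝ≥0∞} (hk : Measurable (Function.uncurry k))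
    (hk1 : ∀ x, ∫⁻ y, k x y = 1) {B : ℝ≥0∞} (hB : B ≠ ⊤) (hkB : ∀ x y, k x y ≤ B) {M : ℝ≥0∞}
    (hM : ∀ x, ∫⁻ y, edist x y * k x y ≤ M) {D : ℝ≥0∞}
    (hD : ∀ᵐ x ∂P, ∀ᵐ x' ∂P', edist x x' ≤ D) :
    ∃ γ : Measure (Euc d × Euc d), γ.map Prod.fst = P ∧ γ.map Prod.snd = P' ∧
      ∫⁻ z, edist z.1 z.2 ∂γ ≤
        2 * M + D * ∫⁻ y, (∫⁻ x, k x y ∂P - ∫⁻ x, k x y ∂P') := by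
  have hkl : ∀ x, Measurable fun y => k x y := fun x => hk.comp measurable_prodMk_left
  have hkr : ∀ y, Measurable fun x => k x y := fun y => hk.comp measurable_prodMk_right
  have hsw : Measurable fun z : Euc d × Euc d => k z.2 z.1 := hk.comp measurable_swap
  set p : Euc d → ℝ≥0∞ := fun y => ∫⁻ x, k x y ∂P with hp
  set p' : Euc d → ℝ≥0∞ := fun y => ∫⁻ x, k x y ∂P' with hp'
  have hpm : Measurable p := hsw.lintegral_prod_right'
  have hpm' : Measurable p' := hsw.lintegral_prod_right'
  have hpt : ∀ y, p y ≠ ⊤ := fun y => ne_top_of_le_ne_top hB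
    ((lintegral_mono fun x => hkB x y).trans (by simp))
  have hpt' : ∀ y, p' y ≠ ⊤ := fun y => ne_top_of_le_ne_top hB
    ((lintegral_mono fun x => hkB x y).trans (by simp))
  have hp1 : ∫⁻ y, p y = 1 := by
    rw [hp, lintegral_lintegral_swap hsw.aemeasurable]
    simp [hk1]
  have hp1' : ∫⁻ y, p' y = 1 := by
    rw [hp', lintegral_lintegral_swap hsw.aemeasurable]
    simp [hk1]
  -- With this weight, k(x,y)k(x',y)q(y) makes x and x' conditionally independent given y and
  -- integrates over P × P' to the common mass min(p, p') at y.
  set q : Euc d → ℝ≥0∞ := fun y => min (p y) (p' y) / (p y * p' y) with hq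
  have hqm : Measurable q := (hpm.min hpm').div (hpm.mul hpm')
  have hr : ∀ y, q y * p' y ≤ 1 := fun y => min_div_mul_mul_le_one (hpt y) (hpt' y)
  have hr' : ∀ y, q y * p y ≤ 1 := fun y => by
    have := min_div_mul_mul_le_one (hpt' y) (hpt y)
    rwa [min_comm, mul_comm (p' y)] at this
  have hpr : ∀ y, p y * (q y * p' y) = min (p y) (p' y) :=
    fun y => mul_min_div_mul_mul (hpt y) (hpt' y)
  have hpr' : ∀ y, p' y * (q y * p y) = min (p y) (p' y) := fun y => by
    rw [← hpr]; ring
  -- The part of the marginal at x that the common mass leaves uncovered; a' plays the same role for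
  -- P'.
  set a : Euc d → ℝ≥0∞ := fun x => ∫⁻ y, k x y * (1 - q y * p' y) with ha
  set a' : Euc d → ℝ≥0∞ := fun x => ∫⁻ y, k x y * (1 - q y * p y) with ha'
  have ham : Measurable a := by
    refine Measurable.lintegral_prod_right' (f := fun z : Euc d × Euc d =>
      k z.1 z.2 * (1 - q z.2 * p' z.2)) (hk.mul (measurable_const.sub ?_))
    exact (hqm.mul hpm').comp measurable_snd
  have ham' : Measurable a' := by
    refine Measurable.lintegral_prod_right' (f := fun z : Euc d × Euc d =>
      k z.1 z.2 * (1 - q z.2 * p z.2)) (hk.mul (measurable_const.sub ?_))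
    exact (hqm.mul hpm).comp measurable_snd
  have hga : ∀ x, (∫⁻ y, k x y * (q y * p' y)) + a x = 1 := by
    intro x
    have hmx : Measurable fun y => k x y * (q y * p' y) := (hkl x).mul (hqm.mul hpm')
    simp only [ha]
    rw [← lintegral_add_left hmx]
    refine Eq.trans ?_ (hk1 x)
    congr 1; ext y
    rw [← mul_add, add_tsub_cancel_of_le (hr y), mul_one]
  have hga' : ∀ x, (∫⁻ y, k x y * (q y * p y)) + a' x = 1 := by
    intro x
    have hmx : Measurable fun y => k x y * (q y * p y) := (hkl x).mul (hqm.mul hpm)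
    simp only [ha']
    rw [← lintegral_add_left hmx]
    refine Eq.trans ?_ (hk1 x)
    congr 1; ext y
    rw [← mul_add, add_tsub_cancel_of_le (hr' y), mul_one]
  have hmin : ∫⁻ y, min (p y) (p' y) ≠ ⊤ :=
    ne_top_of_le_ne_top ENNReal.one_ne_top (hp1 ▸ lintegral_mono fun y => min_le_left _ _)
  have hintP : ∫⁻ x, a x ∂P = ∫⁻ y, (p y - p' y) := by
    rw [ha, lintegral_lintegral_swap]
    · congr 1; ext y
      rw [lintegral_mul_const _ (hkr y)]
      change p y * _ = _
      rw [ENNReal.mul_sub (fun _ _ => hpt y), mul_one, hpr, tsub_min]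
    · exact (hk.mul (measurable_const.sub ((hqm.mul hpm').comp measurable_snd))).aemeasurable
  have hintP' : ∫⁻ x, a' x ∂P' = ∫⁻ y, (p' y - p y) := by
    rw [ha', lintegral_lintegral_swap]
    · congr 1; ext y
      rw [lintegral_mul_const _ (hkr y)]
      change p' y * _ = _
      rw [ENNReal.mul_sub (fun _ _ => hpt' y), mul_one, hpr', min_comm, tsub_min]
    · exact (hk.mul (measurable_const.sub ((hqm.mul hpm).comp measurable_snd))).aemeasurable
  set m : ℝ≥0∞ := ∫⁻ y, (p y - p' y) with hm
  -- Both smoothed measures have mass 1 and share the finite mass of min(p, p'), so the two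
  -- leftovers have equal mass and can be coupled.
  have hmm : ∫⁻ y, (p' y - p y) = m := by
    have h1 : m + ∫⁻ y, min (p y) (p' y) = 1 := by
      rw [hm, ← lintegral_add_right _ (hpm.min hpm'), ← hp1]
      congr 1; ext y
      rw [← tsub_min, tsub_add_cancel_of_le (min_le_left _ _)]
    have h2 : (∫⁻ y, (p' y - p y)) + ∫⁻ y, min (p y) (p' y) = 1 := by
      rw [← lintegral_add_right _ (hpm.min hpm'), ← hp1']
      congr 1; ext y
      rw [min_comm, ← tsub_min, tsub_add_cancel_of_le (min_le_left _ _)]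
    exact (ENNReal.add_left_inj hmin).1 (h2.trans h1.symm)
  rw [hmm] at hintP'
  have hmt : m ≠ ⊤ := ne_top_of_le_ne_top ENNReal.one_ne_top
    (hp1 ▸ lintegral_mono fun y => tsub_le_self)
  -- For m = 0 the quotient m / m is 0 instead of 1, but then the leftover density vanishes almost
  -- everywhere.
  have hdiv : ∀ (Q : Measure (Euc d)) (b : Euc d → ℝ≥0∞), Measurable b → ∫⁻ x, b x ∂Q = m →
      ∀ᵐ x ∂Q, b x * (m / m) = b x := by
    intro Q b hb hbm
    rcases eq_or_ne m 0 with h0 | h0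
    · rw [h0, lintegral_eq_zero_iff hb] at hbm
      filter_upwards [hbm] with x hx
      simp only [Pi.zero_apply] at hx
      rw [hx, zero_mul]
    · exact Filter.Eventually.of_forall fun x => by rw [ENNReal.div_self h0 hmt, mul_one]
  set g : Euc d × Euc d → ℝ≥0∞ := fun z => ∫⁻ y, k z.1 y * k z.2 y * q y with hg
  have hkk : Measurable fun w : (Euc d × Euc d) × Euc d => k w.1.1 w.2 * k w.1.2 w.2 * q w.2 :=
    ((hk.comp (by fun_prop : Measurable fun w : (Euc d × Euc d) × Euc d => (w.1.1, w.2))).mul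
      (hk.comp (by fun_prop : Measurable fun w : (Euc d × Euc d) × Euc d => (w.1.2, w.2)))).mul
      (hqm.comp measurable_snd)
  have hgm : Measurable g := hkk.lintegral_prod_right'
  -- The glued common part plus the normalised product of the leftovers, as a density against P ×
  -- P'.
  set h : Euc d × Euc d → ℝ≥0∞ := fun z => g z + a z.1 * a' z.2 / m with hh
  have hrm : Measurable fun z : Euc d × Euc d => a z.1 * a' z.2 / m :=
    ((ham.comp measurable_fst).mul (ham'.comp measurable_snd)).div_const m
  have hhm : Measurable h := hgm.add hrm
  have hqt : ∀ y, Measurable fun x => k x y * q y := fun y => (hkr y).mul_const _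
  refine ⟨(P.prod P').withDensity h, map_fst_withDensity_prod hhm ?_,
    map_snd_withDensity_prod hhm ?_, ?_⟩
  · filter_upwards [hdiv P a ham hintP] with x hx
    have hmx : Measurable fun x' => g (x, x') := hgm.comp measurable_prodMk_left
    simp only [hh]
    rw [lintegral_add_left hmx]
    have e1 : ∫⁻ x', g (x, x') ∂P' = ∫⁻ y, k x y * (q y * p' y) := by
      rw [hg, lintegral_lintegral_swap]
      · congr 1; ext y
        simp_rw [mul_assoc]
        rw [lintegral_const_mul _ (hqt y), lintegral_mul_const _ (hkr y), mul_comm (q y)]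
      · exact (hkk.comp (by fun_prop :
          Measurable fun w : Euc d × Euc d => ((x, w.1), w.2))).aemeasurable
    have e2 : ∫⁻ x', a x * a' x' / m ∂P' = a x := by
      simp_rw [mul_div_assoc]
      rw [lintegral_const_mul _ (ham'.div_const m)]
      simp_rw [div_eq_mul_inv]
      rw [lintegral_mul_const _ ham', hintP', ← div_eq_mul_inv, hx]
    rw [e1, e2, hga]
  · filter_upwards [hdiv P' a' ham' hintP'] with x' hx
    have hmx : Measurable fun x => g (x, x') := hgm.comp measurable_prodMk_right
    simp only [hh]
    rw [lintegral_add_left hmx]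
    have e1 : ∫⁻ x, g (x, x') ∂P = ∫⁻ y, k x' y * (q y * p y) := by
      rw [hg, lintegral_lintegral_swap]
      · congr 1; ext y
        simp_rw [mul_assoc]
        rw [lintegral_mul_const _ (hkr y)]
        change p y * _ = _
        ring
      · exact (hkk.comp (by fun_prop :
          Measurable fun w : Euc d × Euc d => ((w.1, x'), w.2))).aemeasurable
    have e2 : ∫⁻ x, a x * a' x' / m ∂P = a' x' := by
      simp_rw [mul_div_assoc]
      rw [lintegral_mul_const _ ham, hintP, ← mul_div_assoc, mul_comm m, mul_div_assoc, hx]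
    rw [e1, e2, hga']
  · rw [lintegral_withDensity_eq_lintegral_mul _ hhm (by fun_prop)]
    have hcost : ∀ z : Euc d × Euc d, (h * fun z : Euc d × Euc d => edist z.1 z.2) z =
        edist z.1 z.2 * g z + edist z.1 z.2 * (a z.1 * a' z.2 / m) := by
      intro z
      simp only [hh, Pi.mul_apply]
      ring
    simp_rw [hcost]
    have hem : Measurable fun z : Euc d × Euc d => edist z.1 z.2 * g z := measurable_edist.mul hgm
    rw [lintegral_add_left hem]
    have hT3 : ∫⁻ z, edist z.1 z.2 * (a z.1 * a' z.2 / m) ∂P.prod P' ≤ D * m := by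
      have her : Measurable fun z : Euc d × Euc d => edist z.1 z.2 * (a z.1 * a' z.2 / m) :=
        measurable_edist.mul hrm
      rw [lintegral_prod _ her.aemeasurable]
      calc _ ≤ ∫⁻ x, D * (a x * (m / m)) ∂P := by
            refine lintegral_mono_ae ?_
            filter_upwards [hD] with x hx
            calc _ ≤ ∫⁻ x', D * (a x * (a' x' / m)) ∂P' := by
                  refine lintegral_mono_ae ?_
                  filter_upwards [hx] with x' hx'
                  rw [mul_div_assoc]
                  gcongr
              _ = _ := by
                  rw [lintegral_const_mul _ ((ham'.div_const m).const_mul _),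
                    lintegral_const_mul _ (ham'.div_const m)]
                  simp_rw [div_eq_mul_inv]
                  rw [lintegral_mul_const _ ham', hintP']
        _ ≤ ∫⁻ x, D * a x ∂P := by
            refine lintegral_mono fun x => ?_
            gcongr
            exact mul_le_of_le_one_right' ENNReal.div_self_le_one
        _ = D * m := by rw [lintegral_const_mul _ ham, hintP]
    exact add_le_add (lintegral_edist_mul_lintegral_le P P' hk hM hqm hr hr') hT3

end Coupling

/-! ### Smoothing by a band-limited density. -/

section SmoothingKernel

open Complex FourierTransform

variable {d : ℕ}

/-- Squaring the modulus gives a nonnegative function whose frequencies are differences of points of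
the support of ρ, so compact support of ρ limits the band. -/
lemma normSq_fourier_eq_integral_prod (ρ : Euc d → ℝ) (w : Euc d) :
    ((‖𝓕 (fun v => (ρ v : ℂ)) w‖ ^ 2 : ℝ) : ℂ) =
      ∫ z : Euc d × Euc d, ((ρ z.1 * ρ z.2 : ℝ) : ℂ) *
        cexp ((inner ℝ w ((2 * Real.pi) • (z.2 - z.1)) : ℝ) * I) ∂volume.prod volume := by
  set F : Euc d → ℂ := fun v => cexp ((-2 * Real.pi * inner ℝ v w : ℝ) * I) * (ρ v : ℂ) with hF
  have h1 : 𝓕 (fun v => (ρ v : ℂ)) w = ∫ v, F v := by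
    rw [Real.fourier_eq']; rfl
  have h2 : (starRingEnd ℂ) (∫ v, F v) = ∫ v, (starRingEnd ℂ) (F v) := integral_conj.symm
  rw [h1, ← Complex.normSq_eq_norm_sq, ← Complex.mul_conj, h2, ← integral_prod_mul]
  congr 1; ext z
  simp only [hF, map_mul, Complex.conj_ofReal, ← Complex.exp_conj, Complex.conj_I]
  rw [mul_mul_mul_comm, ← Complex.exp_add, mul_comm, Complex.ofReal_mul (ρ z.1)]
  congr 2
  rw [inner_smul_right, inner_sub_right, real_inner_comm w z.1, real_inner_comm w z.2]
  push_cast; ring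

/-- By Fubini, the smoothed measure depends on P only through `charFun P` at the rescaled
differences z₁ - z₂. -/
lemma integral_normSq_fourier_comp (ρ : Euc d → ℝ) (hρ : Integrable ρ) (P : Measure (Euc d))
    [IsProbabilityMeasure P] (h : ℝ) (y : Euc d) :
    ((∫ x, ‖𝓕 (fun v => (ρ v : ℂ)) (h⁻¹ • (y - x))‖ ^ 2 ∂P : ℝ) : ℂ) =
      ∫ z : Euc d × Euc d, ((ρ z.1 * ρ z.2 : ℝ) : ℂ) *
        (cexp ((inner ℝ y ((2 * Real.pi * h⁻¹) • (z.2 - z.1)) : ℝ) * I) *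
          charFun P ((2 * Real.pi * h⁻¹) • (z.1 - z.2))) ∂volume.prod volume := by
  rw [← integral_complex_ofReal]
  simp_rw [normSq_fourier_eq_integral_prod]
  have hρ2 : Integrable (fun z : Euc d × Euc d => ((ρ z.1 * ρ z.2 : ℝ) : ℂ))
      (volume.prod volume) := (hρ.mul_prod hρ).ofReal
  have hint : Integrable (Function.uncurry fun (x : Euc d) (z : Euc d × Euc d) =>
      ((ρ z.1 * ρ z.2 : ℝ) : ℂ) *
        cexp ((inner ℝ (h⁻¹ • (y - x)) ((2 * Real.pi) • (z.2 - z.1)) : ℝ) * I))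
      (P.prod (volume.prod volume)) := by
    refine Integrable.mul_bdd (c := 1) (hρ2.comp_snd P) ?_ ?_
    · exact Continuous.aestronglyMeasurable (by fun_prop)
    · exact Filter.Eventually.of_forall fun _ => (Complex.norm_exp_ofReal_mul_I _).le
  rw [integral_integral_swap hint]
  congr 1; ext z
  rw [charFun_apply, ← integral_const_mul (cexp _), ← integral_const_mul]
  congr 1; ext x
  congr 1
  rw [← Complex.exp_add]
  congr 1
  simp only [inner_smul_left, inner_smul_right, inner_sub_left, inner_sub_right, conj_trivial]
  push_cast; ring

lemma abs_integral_normSq_fourier_sub_le {ρ : Euc d → ℝ} (hρ : Integrable ρ) {r : ℝ}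
    (hr : ∀ v, r < ‖v‖ → ρ v = 0) (P P' : Measure (Euc d)) [IsProbabilityMeasure P]
    [IsProbabilityMeasure P'] {h : ℝ} (hh : 0 < h) {η : ℝ}
    (hη : ∀ ξ, ‖ξ‖ ≤ 4 * Real.pi * r / h → ‖charFun P ξ - charFun P' ξ‖ ≤ η) (y : Euc d) :
    |(∫ x, ‖𝓕 (fun v => (ρ v : ℂ)) (h⁻¹ • (y - x))‖ ^ 2 ∂P) -
      ∫ x, ‖𝓕 (fun v => (ρ v : ℂ)) (h⁻¹ • (y - x))‖ ^ 2 ∂P'| ≤ (∫ v, |ρ v|) ^ 2 * η := by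
  have hρ2 : Integrable (fun z : Euc d × Euc d => ((ρ z.1 * ρ z.2 : ℝ) : ℂ))
      (volume.prod volume) := (hρ.mul_prod hρ).ofReal
  have hm : ∀ Q : Measure (Euc d), IsProbabilityMeasure Q →
      Integrable (fun z : Euc d × Euc d => ((ρ z.1 * ρ z.2 : ℝ) : ℂ) *
        (cexp ((inner ℝ y ((2 * Real.pi * h⁻¹) • (z.2 - z.1)) : ℝ) * I) *
          charFun Q ((2 * Real.pi * h⁻¹) • (z.1 - z.2)))) (volume.prod volume) := by
    intro Q hQ
    refine Integrable.mul_bdd (c := 1) hρ2 ?_ (Filter.Eventually.of_forall fun z => ?_)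
    · refine (Continuous.aestronglyMeasurable (by fun_prop)).mul ?_
      exact (stronglyMeasurable_charFun.comp_measurable (by fun_prop)).aestronglyMeasurable
    · rw [norm_mul, Complex.norm_exp_ofReal_mul_I, one_mul]
      exact norm_charFun_le_one _
  rw [← Real.norm_eq_abs, ← Complex.norm_real, Complex.ofReal_sub,
    integral_normSq_fourier_comp ρ hρ P, integral_normSq_fourier_comp ρ hρ P',
    ← integral_sub (hm P inferInstance) (hm P' inferInstance)]
  calc _ ≤ ∫ z : Euc d × Euc d, |ρ z.1| * |ρ z.2| * η ∂volume.prod volume := by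
        refine norm_integral_le_of_norm_le ((hρ.abs.mul_prod hρ.abs).mul_const η)
          (Filter.Eventually.of_forall fun z => ?_)
        rw [← mul_sub, ← mul_sub, norm_mul, norm_mul, Complex.norm_exp_ofReal_mul_I, one_mul,
          Complex.norm_real, Real.norm_eq_abs, abs_mul]
        rcases lt_or_ge r ‖z.1‖ with h1 | h1
        · simp [hr _ h1]
        rcases lt_or_ge r ‖z.2‖ with h2 | h2
        · simp [hr _ h2]
        -- Both points lie in the ball of radius r, so the frequency has norm at most (2π/h)·2r,
        -- inside the range where η applies.
        refine mul_le_mul_of_nonneg_left (hη _ ?_) (by positivity)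
        have h3 : ‖z.1 - z.2‖ ≤ r + r := (norm_sub_le _ _).trans (add_le_add h1 h2)
        rw [norm_smul, Real.norm_of_nonneg (by positivity)]
        calc 2 * Real.pi * h⁻¹ * ‖z.1 - z.2‖ ≤ 2 * Real.pi * h⁻¹ * (r + r) := by gcongr
          _ = 4 * Real.pi * r / h := by ring
    _ = _ := by
        rw [integral_mul_const, integral_prod_mul (fun v => |ρ v|) (fun v => |ρ v|), sq]

/-- A probability density with finite first moment whose characteristic function has compact
support, so that smoothing with it only sees low frequencies. -/
lemma exists_bandlimited_density (d : ℕ) :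
    ∃ κ : Euc d → ℝ, Continuous κ ∧ (∀ z, 0 ≤ κ z) ∧ (∃ B, ∀ z, κ z ≤ B) ∧ Integrable κ ∧
      ∫ z, κ z = 1 ∧ Integrable (fun z => ‖z‖ * κ z) ∧
      ∃ A > 0, ∃ C ≥ 0, ∀ P P' : Measure (Euc d), IsProbabilityMeasure P →
        IsProbabilityMeasure P' → ∀ h > 0, ∀ η : ℝ,
        (∀ ξ, ‖ξ‖ ≤ A / h → ‖charFun P ξ - charFun P' ξ‖ ≤ η) → ∀ y,
        |(∫ x, κ (h⁻¹ • (y - x)) ∂P) - ∫ x, κ (h⁻¹ • (y - x)) ∂P'| ≤ C * η := by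
  let b : ContDiffBump (0 : Euc d) := ⟨1, 2, one_pos, one_lt_two⟩
  set ρ : Euc d → ℝ := fun v => b v
  have hρi : Integrable ρ := b.continuous.integrable_of_hasCompactSupport b.hasCompactSupport
  have hρr : ∀ v, (2 : ℝ) < ‖v‖ → ρ v = 0 := fun v hv =>
    b.zero_of_le_dist (by rw [dist_zero_right]; exact hv.le)
  have hcs : HasCompactSupport (fun v => (ρ v : ℂ)) :=
    b.hasCompactSupport.comp_left (g := fun x : ℝ => (x : ℂ)) Complex.ofReal_zero
  have hsm : ContDiff ℝ (⊤ : ℕ∞) (fun v => (ρ v : ℂ)) :=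
    Complex.ofRealCLM.contDiff.comp b.contDiff
  -- The transform of a smooth bump is Schwartz, which supplies the bound, integrability and first
  -- moment of its squared modulus.
  set σ : SchwartzMap (Euc d) ℂ := hcs.toSchwartzMap hsm with hσ
  set f : SchwartzMap (Euc d) ℂ := 𝓕 σ with hf
  have hfc : ∀ w, f w = 𝓕 (fun v => (ρ v : ℂ)) w := by
    intro w
    rw [hf, SchwartzMap.fourier_coe]
    rfl
  obtain ⟨B, hB⟩ : ∃ B, ∀ z, ‖f z‖ ≤ B := by
    obtain ⟨B, hB⟩ := f.decay 0 0
    exact ⟨B, fun z => by simpa using hB.2 z⟩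
  have hB0 : 0 ≤ B := (norm_nonneg _).trans (hB 0)
  have hfcont : Continuous f := f.continuous
  have hi : Integrable (fun z => ‖f z‖ ^ 2) := by
    refine (f.integrable.norm.const_mul B).mono' (by fun_prop)
      (Filter.Eventually.of_forall fun z => ?_)
    rw [Real.norm_of_nonneg (by positivity), sq]
    gcongr
    exact hB z
  have hi1 : Integrable (fun z => ‖z‖ * ‖f z‖ ^ 2) := by
    refine ((f.integrable_pow_mul volume 1).const_mul B).mono' (by fun_prop)
      (Filter.Eventually.of_forall fun z => ?_)
    rw [Real.norm_of_nonneg (by positivity), sq, pow_one, mul_left_comm]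
    gcongr
    exact hB z
  -- At frequency 0 the transform is the integral of the bump; with continuity this makes the
  -- normalising constant N positive.
  have hf0 : f 0 ≠ 0 := by
    rw [hfc, Real.fourier_eq']
    simp only [inner_zero_right, mul_zero, Complex.ofReal_zero, zero_mul, Complex.exp_zero,
      one_smul]
    rw [integral_complex_ofReal]
    exact_mod_cast b.integral_pos.ne'
  have hN : 0 < ∫ z, ‖f z‖ ^ 2 := by
    refine integral_pos_of_integrable_nonneg_nonzero (x := 0) (by fun_prop) hi
      (fun z => by positivity) ?_
    positivity
  set N := ∫ z, ‖f z‖ ^ 2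
  refine ⟨fun z => ‖f z‖ ^ 2 / N, (hfcont.norm.pow 2).div_const N,
    fun z => div_nonneg (sq_nonneg _) hN.le, ⟨B ^ 2 / N, fun z => ?_⟩, hi.div_const N, ?_, ?_,
    4 * Real.pi * 2, by positivity, (∫ v, |ρ v|) ^ 2 / N, div_nonneg (sq_nonneg _) hN.le, ?_⟩
  · exact div_le_div_of_nonneg_right (pow_le_pow_left₀ (norm_nonneg _) (hB z) 2) hN.le
  · rw [integral_div, div_self hN.ne']
  · simpa only [mul_div_assoc] using hi1.div_const N
  · intro P P' hP hP' h hh η hη y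
    have key := abs_integral_normSq_fourier_sub_le hρi hρr P P' hh hη y
    have e : ∀ Q : Measure (Euc d), ∫ x, ‖f (h⁻¹ • (y - x))‖ ^ 2 / N ∂Q =
        (∫ x, ‖𝓕 (fun v => (ρ v : ℂ)) (h⁻¹ • (y - x))‖ ^ 2 ∂Q) / N := by
      intro Q
      simp only [hfc]
      exact integral_div _ _
    rw [e, e, ← sub_div, abs_div, abs_of_pos hN, div_mul_eq_mul_div]
    exact div_le_div_of_nonneg_right key hN.le

end SmoothingKernel

/-! ### From close characteristic functions to small Wasserstein distance. -/

lemma wasserstein1_le_of_coupling {d : ℕ} {P P' : ProbabilityMeasure (Euc d)}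
    {γ : Measure (Euc d × Euc d)} (h1 : γ.map Prod.fst = (P : Measure (Euc d)))
    (h2 : γ.map Prod.snd = (P' : Measure (Euc d))) {w : ℝ} (hw : 0 ≤ w)
    (hγ : ∫⁻ z, edist z.1 z.2 ∂γ ≤ ENNReal.ofReal w) : wasserstein1 P P' ≤ w :=
  ENNReal.toReal_le_of_le_ofReal hw ((iInf₂_le γ ⟨h1, h2⟩).trans hγ)

lemma wasserstein1_nonneg {d : ℕ} (P P' : ProbabilityMeasure (Euc d)) : 0 ≤ wasserstein1 P P' :=
  ENNReal.toReal_nonneg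

/-- Smoothing a measure on the ball of radius `R` puts mass at most the mean displacement outside
the ball of radius `R + 1`. -/
lemma setLIntegral_compl_closedBall_le {d : ℕ} {R : ℝ} (P : Measure (Euc d))
    [IsProbabilityMeasure P] (hP : ∀ᵐ x ∂P, ‖x‖ ≤ R) {k : Euc d → Euc d → ENNReal}
    (hk : Measurable (Function.uncurry k)) {M : ENNReal}
    (hM : ∀ x, ∫⁻ y, edist x y * k x y ≤ M) :
    ∫⁻ y in (Metric.closedBall (0 : Euc d) (R + 1))ᶜ, (∫⁻ x, k x y ∂P) ≤ M := by
  have hsw : Measurable (Function.uncurry fun y x => k x y) := hk.comp measurable_swap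
  calc _ = ∫⁻ x, (∫⁻ y in (Metric.closedBall (0 : Euc d) (R + 1))ᶜ, k x y) ∂P :=
        lintegral_lintegral_swap hsw.aemeasurable
    _ ≤ ∫⁻ _, M ∂P := by
        refine lintegral_mono_ae ?_
        filter_upwards [hP] with x hx
        refine le_trans ?_ ((setLIntegral_le_lintegral (Metric.closedBall (0 : Euc d) (R + 1))ᶜ
          (fun y => edist x y * k x y)).trans (hM x))
        refine setLIntegral_mono' Metric.isClosed_closedBall.measurableSet.compl fun y hy => ?_
        -- Markov's inequality: leaving the larger ball from a point of the smaller one requires a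
        -- displacement of at least 1.
        refine le_mul_of_one_le_left' ?_
        rw [Set.mem_compl_iff, mem_closedBall_zero_iff, not_le] at hy
        rw [edist_dist, dist_comm, dist_eq_norm, ENNReal.one_le_ofReal]
        have := norm_sub_norm_le y x
        linarith
    _ = M := by simp

/-- A quantitative smoothing inequality: closeness of the characteristic functions at frequencies
up to `A / h` controls the Wasserstein distance up to `O(h)`. -/
lemma exists_wasserstein1_le_of_charFun_close (d : ℕ) {R : ℝ} (hR : 0 ≤ R) :
    ∃ C₁ > 0, ∃ C₂ ≥ 0, ∃ A > 0, ∀ P P' : ProbabilityMeasure (Euc d),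
      (∀ᵐ x ∂(P : Measure (Euc d)), ‖x‖ ≤ R) → (∀ᵐ x ∂(P' : Measure (Euc d)), ‖x‖ ≤ R) →
      ∀ h > 0, ∀ η ≥ 0,
      (∀ ξ, ‖ξ‖ ≤ A / h →
        ‖charFun (P : Measure (Euc d)) ξ - charFun (P' : Measure (Euc d)) ξ‖ ≤ η) →
      wasserstein1 P P' ≤ C₁ * h + C₂ * (h⁻¹ ^ d * η) := by
  obtain ⟨κ, hκc, hκ0, ⟨B, hB⟩, hκi, hκ1, hκm, A, hA, C, hC, hκ⟩ := exists_bandlimited_density d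
  set M₁ := ∫ z, ‖z‖ * κ z with hM₁
  have hM₁0 : 0 ≤ M₁ := integral_nonneg fun z => mul_nonneg (norm_nonneg _) (hκ0 z)
  set V := (volume (Metric.closedBall (0 : Euc d) (R + 1))).toReal with hV
  have hVt : volume (Metric.closedBall (0 : Euc d) (R + 1)) ≠ ⊤ := measure_closedBall_lt_top.ne
  refine ⟨(2 + 2 * R) * M₁ + 1, by positivity, 2 * R * (V * C), by positivity, A, hA, ?_⟩
  intro P P' hP hP' h hh η hη hclose
  set f : Euc d → Euc d → ℝ := fun x y => h⁻¹ ^ d * κ (h⁻¹ • (y - x)) with hf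
  have hf0 : ∀ x y, 0 ≤ f x y := fun x y => mul_nonneg (by positivity) (hκ0 _)
  have hfcont : Continuous (Function.uncurry f) := by
    simp only [hf, Function.uncurry_def]
    fun_prop
  have hfr : ∀ y, Continuous fun x => f x y := fun y =>
    hfcont.comp (by fun_prop : Continuous fun x => (x, y))
  have hfB : ∀ x y, f x y ≤ h⁻¹ ^ d * B := fun x y =>
    mul_le_mul_of_nonneg_left (hB _) (by positivity)
  set k : Euc d → Euc d → ENNReal := fun x y => ENNReal.ofReal (f x y) with hk
  have hkm : Measurable (Function.uncurry k) := hfcont.measurable.ennreal_ofReal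
  have hscale : ∀ (g : Euc d → ℝ) (x : Euc d),
      ∫ y, h⁻¹ ^ d * g (h⁻¹ • (y - x)) = ∫ z, g z := by
    intro g x
    rw [integral_const_mul, integral_sub_right_eq_self (fun y => g (h⁻¹ • y)) x,
      Measure.integral_comp_smul, finrank_euclideanSpace_fin, abs_of_nonneg (by positivity),
      smul_eq_mul, mul_inv_cancel_left₀ (by positivity)]
  have hscalei : ∀ (g : Euc d → ℝ), Integrable g → ∀ x : Euc d,
      Integrable fun y => h⁻¹ ^ d * g (h⁻¹ • (y - x)) := by
    intro g hg x
    exact ((hg.comp_smul (inv_ne_zero hh.ne')).comp_sub_right x).const_mul _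
  have hk1 : ∀ x, ∫⁻ y, k x y = 1 := by
    intro x
    rw [← ofReal_integral_eq_lintegral_ofReal (hscalei κ hκi x)
      (Filter.Eventually.of_forall (hf0 x)), hscale, hκ1, ENNReal.ofReal_one]
  have hM : ∀ x, ∫⁻ y, edist x y * k x y ≤ ENNReal.ofReal (h * M₁) := by
    intro x
    have e : ∀ y, edist x y * k x y =
        ENNReal.ofReal (h * (h⁻¹ ^ d * (fun z => ‖z‖ * κ z) (h⁻¹ • (y - x)))) := by
      intro y
      rw [edist_dist, hk, ← ENNReal.ofReal_mul dist_nonneg, dist_comm, dist_eq_norm]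
      congr 1
      simp only [hf, norm_smul, norm_inv, Real.norm_of_nonneg hh.le]
      field_simp
    simp_rw [e]
    rw [← ofReal_integral_eq_lintegral_ofReal ((hscalei _ hκm x).const_mul h)
      (Filter.Eventually.of_forall fun y => mul_nonneg hh.le (mul_nonneg (by positivity)
        (mul_nonneg (norm_nonneg _) (hκ0 _)))), integral_const_mul]
    exact (congrArg (fun t => ENNReal.ofReal (h * t)) (hscale (fun z => ‖z‖ * κ z) x)).le
  have hD : ∀ᵐ x ∂(P : Measure (Euc d)), ∀ᵐ x' ∂(P' : Measure (Euc d)),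
      edist x x' ≤ ENNReal.ofReal (2 * R) := by
    filter_upwards [hP] with x hx
    filter_upwards [hP'] with x' hx'
    rw [edist_dist, dist_eq_norm]
    exact ENNReal.ofReal_le_ofReal ((norm_sub_le _ _).trans (by linarith))
  obtain ⟨γ, h1, h2, h3⟩ := exists_coupling_of_kernel (P : Measure (Euc d)) (P' : Measure (Euc d))
    hkm hk1 ENNReal.ofReal_ne_top (fun x y => ENNReal.ofReal_le_ofReal (hfB x y)) hM hD
  have hfi : ∀ (Q : Measure (Euc d)) [IsProbabilityMeasure Q] y, Integrable (fun x => f x y) Q := by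
    intro Q _ y
    refine Integrable.of_bound (C := h⁻¹ ^ d * B) (hfr y).aestronglyMeasurable
      (Filter.Eventually.of_forall fun x => ?_)
    rw [Real.norm_of_nonneg (hf0 x y)]
    exact hfB x y
  have hdens : ∀ (Q : Measure (Euc d)) [IsProbabilityMeasure Q] y,
      ∫⁻ x, k x y ∂Q = ENNReal.ofReal (h⁻¹ ^ d * ∫ x, κ (h⁻¹ • (y - x)) ∂Q) := by
    intro Q _ y
    rw [← integral_const_mul]
    exact (ofReal_integral_eq_lintegral_ofReal (hfi Q y)
      (Filter.Eventually.of_forall fun x => hf0 x y)).symm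
  have hdiff : ∀ y, (∫⁻ x, k x y ∂(P : Measure (Euc d))) - ∫⁻ x, k x y ∂(P' : Measure (Euc d)) ≤
      ENNReal.ofReal (h⁻¹ ^ d * (C * η)) := by
    intro y
    have hi0 : ∀ Q : Measure (Euc d), 0 ≤ ∫ x, κ (h⁻¹ • (y - x)) ∂Q :=
      fun Q => integral_nonneg fun x => hκ0 _
    rw [hdens, hdens, ← ENNReal.ofReal_sub _ (mul_nonneg (by positivity) (hi0 _)), ← mul_sub]
    refine ENNReal.ofReal_le_ofReal (mul_le_mul_of_nonneg_left ?_ (by positivity))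
    exact (le_abs_self _).trans (hκ P P' inferInstance inferInstance h hh η hclose y)
  have hfar := setLIntegral_compl_closedBall_le (P : Measure (Euc d)) hP hkm hM
  -- On the ball of radius R + 1 the uniform bound on the densities is multiplied by the volume V.
  -- Outside it (p - p')⁺ ≤ p, whose mass there is at most hM₁.
  have htv : ∫⁻ y, ((∫⁻ x, k x y ∂(P : Measure (Euc d))) - ∫⁻ x, k x y ∂(P' : Measure (Euc d))) ≤
      ENNReal.ofReal (V * (h⁻¹ ^ d * (C * η)) + h * M₁) := by
    rw [← lintegral_add_compl _ (measurableSet_closedBall (x := (0 : Euc d)) (ε := R + 1)),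
      ENNReal.ofReal_add (by positivity) (by positivity)]
    refine add_le_add ?_ ((lintegral_mono fun y => tsub_le_self).trans hfar)
    refine (lintegral_mono fun y => hdiff y).trans ?_
    rw [setLIntegral_const, mul_comm, ENNReal.ofReal_mul ENNReal.toReal_nonneg,
      ENNReal.ofReal_toReal hVt]
  refine (wasserstein1_le_of_coupling h1 h2
    (w := 2 * (h * M₁) + 2 * R * (V * (h⁻¹ ^ d * (C * η)) + h * M₁)) (by positivity) ?_).trans ?_
  · refine h3.trans ?_
    rw [ENNReal.ofReal_add (by positivity) (by positivity),
      ENNReal.ofReal_mul (p := 2) (q := h * M₁) (by norm_num),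
      ENNReal.ofReal_mul (p := 2 * R) (q := _ + _) (by positivity), ENNReal.ofReal_ofNat]
    gcongr
  · have : 2 * (h * M₁) + 2 * R * (V * (h⁻¹ ^ d * (C * η)) + h * M₁) =
        (2 + 2 * R) * M₁ * h + 2 * R * (V * C) * (h⁻¹ ^ d * η) := by ring
    rw [this]
    gcongr
    linarith

/-! ### Deconvolution and the final bound. -/

lemma pow_le_factorial_mul_exp {x : ℝ} (hx : 0 ≤ x) (n : ℕ) :
    x ^ n ≤ n.factorial * Real.exp x := by
  have := Real.pow_div_factorial_le_exp x hx n
  rwa [div_le_iff₀ (by positivity), mul_comm] at this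

lemma norm_charFun_sub_le_of_l1Dist {d : ℕ} {lmin lmax C₀ ε : ℝ} (hC₀ : 0 < C₀)
    {S S' : Matrix (Fin d) (Fin d) ℝ} (hS : S ∈ boundedPosDef d lmin lmax)
    (hS' : S' ∈ boundedPosDef d lmin lmax) (P P' : ProbabilityMeasure (Euc d))
    (hε : l1Dist (mixtureDensity (cauchyKernel d) (P, S))
      (mixtureDensity (cauchyKernel d) (P', S')) = ε) (hε1 : ε ≤ 1)
    (hscale : C₀ * symOpNorm (S - S') ^ 2 ≤ ε) (ξ : Euc d) :
    ‖charFun (P : Measure (Euc d)) ξ - charFun (P' : Measure (Euc d)) ξ‖ ≤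
      (1 + (√√C₀)⁻¹) * √√ε * Real.exp ((√lmax + 1) * ‖ξ‖) := by
  have hε0 : 0 ≤ ε := hε ▸ l1Dist_nonneg _ _
  -- The scale bound gives ‖S - S'‖ = O(√ε), and the √-modulus halves the exponent again; hence the
  -- fourth root.
  have hδ : √(symOpNorm (S - S')) ≤ (√√C₀)⁻¹ * √√ε := by
    have h1 : symOpNorm (S - S') ≤ √(ε / C₀) :=
      Real.le_sqrt_of_sq_le ((le_div_iff₀ hC₀).2 (by linarith))
    refine (Real.sqrt_le_sqrt h1).trans (le_of_eq ?_)
    rw [Real.sqrt_div hε0, Real.sqrt_div (Real.sqrt_nonneg _), div_eq_inv_mul]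
  have hε4 : ε ≤ √√ε := by
    have h1 : ε ≤ √ε := Real.le_sqrt_of_sq_le (by nlinarith)
    exact h1.trans (Real.sqrt_le_sqrt h1)
  set Φ := kernelCharFun (cauchyKernel d) S ξ with hΦ
  set Φ' := kernelCharFun (cauchyKernel d) S' ξ with hΦ'
  set φ := charFun (P : Measure (Euc d)) ξ with hφ
  set φ' := charFun (P' : Measure (Euc d)) ξ with hφ'
  have hΦle : ∀ T : Matrix (Fin d) (Fin d) ℝ, T.PosDef →
      ‖kernelCharFun (cauchyKernel d) T ξ‖ ≤ 1 := by
    intro T hT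
    rw [norm_kernelCharFun_cauchyKernel hT]
    exact Real.exp_le_one_iff.2 (neg_nonpos.2 (Real.sqrt_nonneg _))
  have hΦlow : Real.exp (-(√lmax * ‖ξ‖)) ≤ ‖Φ‖ := by
    rw [hΦ, norm_kernelCharFun_cauchyKernel hS.1]
    exact Real.exp_le_exp.2 (neg_le_neg (sqrt_quadForm_bounds hS ξ).2)
  have hmod : ‖Φ' - Φ‖ ≤ √(symOpNorm (S - S')) * ‖ξ‖ := by
    refine (norm_kernelCharFun_cauchyKernel_sub_le hS.1 hS'.1 ξ).trans ?_
    exact mul_le_of_le_one_right (by positivity) (max_le (hΦle _ hS'.1) (hΦle _ hS.1))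
  have hl1 : ‖Φ * φ - Φ' * φ'‖ ≤ ε := hε ▸ norm_charFun_sub_le_l1Dist hS.1 hS'.1 P P' ξ
  have hsum : ‖Φ‖ * ‖φ - φ'‖ ≤ ε + √(symOpNorm (S - S')) * ‖ξ‖ := by
    -- Exchanging Φ' for Φ leaves the L¹ error plus a scale error that the modulus controls.
    rw [← norm_mul, show Φ * (φ - φ') = (Φ * φ - Φ' * φ') + (Φ' - Φ) * φ' by ring]
    refine (norm_add_le _ _).trans (add_le_add hl1 ?_)
    rw [norm_mul]
    exact (mul_le_of_le_one_right (norm_nonneg _) (norm_charFun_le_one _)).trans hmod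
  have hbound : Real.exp (-(√lmax * ‖ξ‖)) * ‖φ - φ'‖ ≤
      (1 + (√√C₀)⁻¹) * √√ε * Real.exp ‖ξ‖ := by
    have e1 : (1 : ℝ) ≤ Real.exp ‖ξ‖ := Real.one_le_exp (norm_nonneg _)
    have e2 : ‖ξ‖ ≤ Real.exp ‖ξ‖ := by linarith [Real.add_one_le_exp ‖ξ‖]
    calc Real.exp (-(√lmax * ‖ξ‖)) * ‖φ - φ'‖ ≤ ‖Φ‖ * ‖φ - φ'‖ := by gcongr
      _ ≤ ε + √(symOpNorm (S - S')) * ‖ξ‖ := hsum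
      _ ≤ √√ε * Real.exp ‖ξ‖ + (√√C₀)⁻¹ * √√ε * Real.exp ‖ξ‖ := by
        refine add_le_add (hε4.trans (le_mul_of_one_le_right (by positivity) e1)) ?_
        gcongr
      _ = _ := by ring
  rw [Real.exp_neg, inv_mul_le_iff₀ (Real.exp_pos _)] at hbound
  refine hbound.trans (le_of_eq ?_)
  rw [add_mul (√lmax), one_mul, Real.exp_add]
  ring

/-- The deconvolution bound: the `L¹` distance of Cauchy mixtures controls the Wasserstein distance
of the mixing measures at a logarithmic rate. -/
lemma exists_expNegDiv_wasserstein1_le (d : ℕ) {R lmin lmax C₀ : ℝ} (hR : 0 < R) (hC₀ : 0 < C₀) :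
    ∃ C > 0, ∃ C' > 0, ∀ P P' : ProbabilityMeasure (Euc d),
      (∀ᵐ x ∂(P : Measure (Euc d)), ‖x‖ ≤ R) → (∀ᵐ x ∂(P' : Measure (Euc d)), ‖x‖ ≤ R) →
      ∀ S ∈ boundedPosDef d lmin lmax, ∀ S' ∈ boundedPosDef d lmin lmax,
      C₀ * symOpNorm (S - S') ^ 2 ≤ l1Dist (mixtureDensity (cauchyKernel d) (P, S))
        (mixtureDensity (cauchyKernel d) (P', S')) →
      C' * expNegDiv C (wasserstein1 P P') ≤ l1Dist (mixtureDensity (cauchyKernel d) (P, S))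
        (mixtureDensity (cauchyKernel d) (P', S')) := by
  obtain ⟨C₁, hC₁, C₂, hC₂, A, hA, hW⟩ := exists_wasserstein1_le_of_charFun_close d hR.le
  set D := (1 + (√√C₀)⁻¹) with hD
  have hD0 : 0 < D := by positivity
  set a := (√lmax + 1) * A with ha
  have ha0 : 0 < a := by positivity
  -- With h = W/(2C₁), the first term of K/W is the exponent (1 + a)/h and the final 1 accounts for
  -- e^{-1/W} ≤ W. The later factors 4K and H⁻⁴ undo the fourth root of ε.
  set K := (1 + a) * (2 * C₁) + 1 with hK
  set H := 2 * (C₂ * (d.factorial * D)) + 1 with hH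
  have hH0 : 1 ≤ H := by rw [hH]; linarith [show 0 ≤ C₂ * (d.factorial * D) by positivity]
  refine ⟨4 * K, by positivity, (H ^ 4)⁻¹, by positivity, ?_⟩
  intro P P' hP hP' S hS S' hS' hscale
  set ε := l1Dist (mixtureDensity (cauchyKernel d) (P, S))
    (mixtureDensity (cauchyKernel d) (P', S')) with hε
  have hε0 : 0 ≤ ε := l1Dist_nonneg _ _
  set W := wasserstein1 P P' with hWdef
  unfold expNegDiv
  split_ifs with hW0
  · simpa using hε0
  have hWpos : 0 < W := lt_of_le_of_ne (wasserstein1_nonneg P P') (Ne.symm hW0)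
  rcases le_or_gt 1 ε with h1 | h1
  · refine le_trans (mul_le_one₀ (inv_le_one_of_one_le₀ (one_le_pow₀ hH0)) (Real.exp_pos _).le
      (Real.exp_le_one_iff.2 (neg_nonpos.2 (by positivity)))) h1
  set e := √√ε with he
  have he4 : e ^ 4 = ε := by
    rw [show e ^ 4 = (e ^ 2) ^ 2 by ring, he, Real.sq_sqrt (Real.sqrt_nonneg _), Real.sq_sqrt hε0]
  -- This bandwidth makes the smoothing bias C₁h equal to W/2, which is absorbed into the left side.
  set h := W / (2 * C₁) with hh
  have hh0 : 0 < h := by positivity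
  have hclose : ∀ ξ, ‖ξ‖ ≤ A / h →
      ‖charFun (P : Measure (Euc d)) ξ - charFun (P' : Measure (Euc d)) ξ‖ ≤
        D * e * Real.exp (a * h⁻¹) := by
    intro ξ hξ
    refine (norm_charFun_sub_le_of_l1Dist hC₀ hS hS' P P' rfl h1.le hscale ξ).trans ?_
    refine mul_le_mul_of_nonneg_left (Real.exp_le_exp.2 ?_) (by positivity)
    calc (√lmax + 1) * ‖ξ‖ ≤ (√lmax + 1) * (A / h) := by gcongr
      _ = a * h⁻¹ := by rw [ha]; ring
  have key := hW P P' hP hP' h hh0 _ (by positivity) hclose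
  have hC1h : C₁ * h = W / 2 := by rw [hh]; field_simp
  -- The factor h^{-d} costs only d!·e^{1/h}, which merges with the exponential loss of
  -- deconvolution.
  have hpow : h⁻¹ ^ d * (D * e * Real.exp (a * h⁻¹)) ≤
      d.factorial * D * e * Real.exp ((1 + a) * h⁻¹) := by
    calc _ ≤ (d.factorial * Real.exp h⁻¹) * (D * e * Real.exp (a * h⁻¹)) := by
          gcongr
          exact pow_le_factorial_mul_exp (by positivity) d
      _ = _ := by rw [add_mul (1 : ℝ) a, one_mul, Real.exp_add]; ring
  have h2 : W ≤ H * (e * Real.exp ((1 + a) * h⁻¹)) := by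
    have h3 : C₂ * (h⁻¹ ^ d * (D * e * Real.exp (a * h⁻¹))) ≤
        C₂ * (d.factorial * D * e * Real.exp ((1 + a) * h⁻¹)) := by gcongr
    have h4 : 0 ≤ e * Real.exp ((1 + a) * h⁻¹) := by positivity
    rw [hH]
    nlinarith
  -- Replaces the linear W by an exponential, so that the estimate takes the form e^{-K/W} ≤ H
  -- ε^{1/4}.
  have h5 : Real.exp (-W⁻¹) ≤ W := by
    rw [Real.exp_neg]
    refine inv_le_of_inv_le₀ hWpos ?_
    linarith [Real.add_one_le_exp W⁻¹]
  have h6 : Real.exp (-(K / W)) ≤ H * e := by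
    have e1 : Real.exp (-(K / W)) = Real.exp (-W⁻¹) * Real.exp (-((1 + a) * h⁻¹)) := by
      rw [← Real.exp_add]; congr 1; rw [hK, hh]; field_simp; ring
    rw [e1, Real.exp_neg ((1 + a) * h⁻¹), ← div_eq_mul_inv, div_le_iff₀ (Real.exp_pos _), mul_assoc]
    exact h5.trans h2
  have h7 : Real.exp (-(4 * K / W)) = Real.exp (-(K / W)) ^ 4 := by
    rw [← Real.exp_nat_mul]; congr 1; push_cast; ring
  rw [h7, inv_mul_le_iff₀ (by positivity), ← he4, ← mul_pow]
  exact pow_le_pow_left₀ (Real.exp_pos _).le h6 4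

theorem theorem4p3 (d : ℕ) (lmin lmax : ℝ) (hmin : 0 < lmin) (hlt : lmin < lmax) :
    IsSuperSmooth (cauchyKernel d) lmin lmax 1 ∧
    CharFunModulus (cauchyKernel d) lmin lmax Real.sqrt 1 ∧
    ∀ R : ℝ, 0 < R →
      ScaleLowerBound (cauchyKernel d) R lmin lmax (fun t => t ^ 2) ∧
      ∃ C > 0, ∃ C' > 0, ∀ X : Set (Euc d),
        MeasurableSet X → X ⊆ Metric.closedBall 0 R →
        ∀ G ∈ mixingSpace X lmin lmax, ∀ G' ∈ mixingSpace X lmin lmax,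
          C' * (expNegDiv C (wasserstein1 G.1 G'.1) + symOpNorm (G.2 - G'.2) ^ 2) ≤
            l1Dist (mixtureDensity (cauchyKernel d) G)
              (mixtureDensity (cauchyKernel d) G') := by
  refine ⟨isSuperSmooth_cauchyKernel d hmin hlt, charFunModulus_cauchyKernel d lmin lmax,
    fun R hR => ?_⟩
  have hscale := scaleLowerBound_cauchyKernel d (lmin := lmin) hR (hmin.trans hlt)
  refine ⟨hscale, ?_⟩
  obtain ⟨-, C₀, hC₀, h₀⟩ := hscale
  obtain ⟨C, hC, C', hC', h'⟩ :=
    exists_expNegDiv_wasserstein1_le d (lmin := lmin) (lmax := lmax) hR hC₀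
  -- Half the smaller constant lets the two separate lower bounds be averaged; C and C' were fixed
  -- before X, so they are uniform in it.
  refine ⟨C, hC, min C' C₀ / 2, by positivity, fun X hXm hX G hG G' hG' => ?_⟩
  have h1 := h₀ X hXm hX G hG G' hG'
  have h2 := h' G.1 G'.1 (ae_norm_le_of_support_subset hG.1 hX)
    (ae_norm_le_of_support_subset hG'.1 hX) G.2 hG.2 G'.2 hG'.2 h1
  have h3 : 0 ≤ expNegDiv C (wasserstein1 G.1 G'.1) := by
    unfold expNegDiv
    split_ifs
    · exact le_rfl
    · exact (Real.exp_pos _).le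
  have h4 : min C' C₀ * expNegDiv C (wasserstein1 G.1 G'.1) ≤
      C' * expNegDiv C (wasserstein1 G.1 G'.1) := by gcongr; exact min_le_left _ _
  have h5 : min C' C₀ * symOpNorm (G.2 - G'.2) ^ 2 ≤ C₀ * symOpNorm (G.2 - G'.2) ^ 2 := by
    gcongr; exact min_le_right _ _
  linarith
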